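/- **Setting.** For $k\in\mathbb N_0^d$ and $x\in[-1,1]^d$ let $T_k(x)=\sqrt2^{\,\|k\|_0}\prod_{s\in\operatorname{supp}k}\cos(k_s\arccos x_s)$ be the normed Chebyshev polynomials, which are orthonormal with respect to $\omega(x)=\prod_{s=1}^d\frac1{\pi\sqrt{1-x_s^2}}$. Let $U$ be a non-empty set of subsets of $\{1,\dots,d\}$, let $N_u\in\mathbb N$, $N_u\ge 1$, for $u\in U$, and put $I_u=\{k\in\mathbb N_0^d:\operatorname{supp}k=u,\ k_s\le N_u-1\ (s\in u)\}$ (so $I_\emptyset=\{0\}$) and $I(U)=\bigcup_{u\in U}I_u$. For nodes $X=(x_1,\dots,x_M)$ in $[-1,1]^d$, $M=|X|\ge1$, let $F=F(X,I(U))=(T_k(x_j))_{j,\;k\in I(U)}$, with blocks $F_u=(T_k(x_j))_{j,\;k\in I_u}$, $u\in U$. Consider the two least-squares problems 1. $\min_h\|y-F(X,I(U))h\|_2$; 2. $\min_h\|Wy-WF(\tilde X,I(U))h\|_2$, where $\theta\in(0,1)$, $\tilde X=((1-\theta)x_j)_j$, $W=\operatorname{diag}\big(\sqrt{\omega(\tilde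 x_j)}\big)_j$, with data $y\in\mathbb R^M$. Put $Z=X$, $W=\mathrm{Id}$ for problem 1 and $Z=\tilde X$ for problem 2. **Cost model.** Algorithms are straight-line arithmetic programs over $\mathbb R$. Every operation $+,-,\cdot,/,\sqrt{\ }$ and every loading of a real constant costs $1$. Division is total, with $a/0=0$. A call of another program costs as many operations as the called program performs. Programs may depend on $U$, $(N_u)_{u\in U}$, the nodes and $\theta$ (whatever depends on these alone is precomputed), but not on $y$, on the vectors that are multiplied, or on the iteration number. A nonequispaced fast cosine transform (NFCT) of accuracy $\varepsilon$ for the term $u$ and the nodes $Z$ is a program for $h\mapsto G_uh$, where $G_u$ is a matrix each of whose entries differs by at most $\varepsilon$ from that of $F_u=F_u(Z)$; the adjoint NFCT is a program for $f\mapsto G_u^{\top}f$ with the same $G_u$. **Theorem.** For every $d_s\in\mathbb N_0$ and every accuracy $\varepsilon>0$ there is a constant $C=C(d_s,\varepsilon)$ such that for all $d$, all $X$, all $U$ with $|u|\le d_s$ for $u\in U$, all $(N_u)_{u\in U}$ as above, and for problem 1 as well as for problem 2 with any $\theta\in(0,1)$, the following holds. There are an NFCT and an adjoint NFCT of accuracy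 $\varepsilon$ for each $u\in U$ and the nodes $Z$, each with at most $C\,(N_u^{|u|}\log N_u+|X|)$ arithmetic operations, and there is one program that, for every $y$ and every $i\ge0$, computes from the state of the LSQR algorithm of Paige and Saunders after $i$ iterations the state after $i+1$ iterations, where LSQR is run on the problem with the blocks $F_u$ of $F(Z,I(U))$ realized by the blocks $G_u$ of these transforms, i.e. with system matrix $WG$, $G=(G_u)_{u\in U}$, and right-hand side $Wy$. If a vector to be normalized vanishes, it is kept. In one iteration this program calls the NFCT and the adjoint NFCT of each term $u\in U$ exactly once, and the total number of its arithmetic operations, those of the transforms included, is at most $$C\Big(\sum_{u\in U}N_u^{|u|}\log N_u+|X|\,|U|\Big).$$ -/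

import Mathlib

namespace GroupedLSQR

/-! ### Chebyshev system and grouped index sets -/

/-- The normed tensor product Chebyshev polynomial
`T_k(x) = √2 ^ ‖k‖₀ * ∏_{s ∈ supp k} cos (k_s * arccos x_s)`. -/
noncomputable def chebyshevT {d : ℕ} (k : Fin d → ℕ) (x : Fin d → ℝ) : ℝ :=
  Real.sqrt 2 ^ (Finset.univ.filter fun s => k s ≠ 0).card *
    ∏ s ∈ Finset.univ.filter (fun s => k s ≠ 0), Real.cos (k s * Real.arccos (x s))

/-- The Chebyshev product density `ω(x) = ∏_s 1 / (π √(1 - x_s²))`. -/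
noncomputable def chebyshevDensity {d : ℕ} (x : Fin d → ℝ) : ℝ :=
  ∏ s, 1 / (Real.pi * Real.sqrt (1 - x s ^ 2))

/-- The index set `I_u` with parameter `n`: all `k` with `supp k = u` and
`‖k_u‖_∞ ≤ n - 1`; for `u = ∅` it is `{0}`. -/
def termIndexSet {d : ℕ} (n : ℕ) (u : Finset (Fin d)) : Finset (Fin d → ℕ) :=
  Fintype.piFinset fun s => if s ∈ u then Finset.Icc 1 (n - 1) else {0}

theorem mem_termIndexSet {d : ℕ} {n : ℕ} {u : Finset (Fin d)} {k : Fin d → ℕ} :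
    k ∈ termIndexSet n u ↔ (∀ s, k s ≠ 0 ↔ s ∈ u) ∧ ∀ s ∈ u, k s ≤ n - 1 := by
  simp only [termIndexSet, Fintype.mem_piFinset]
  constructor
  · intro h
    refine ⟨fun s => ?_, fun s hs => ?_⟩
    · have := h s
      by_cases hs : s ∈ u
      · simp only [hs, if_true, Finset.mem_Icc] at this
        simp only [hs, iff_true]
        omega
      · simpa [hs] using this
    · have := h s
      simp only [hs, if_true, Finset.mem_Icc] at this
      exact this.2
  · rintro ⟨h1, h2⟩ s
    by_cases hs : s ∈ u
    · simp only [hs, if_true, Finset.mem_Icc]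
      exact ⟨Nat.one_le_iff_ne_zero.2 ((h1 s).2 hs), h2 s hs⟩
    · simpa [hs] using h1 s

/-- The grouped index set `I(U) = ⋃_{u ∈ U} I_u` with parameters `N_u`. -/
def indexSet {d : ℕ} (U : Finset (Finset (Fin d))) (N : Finset (Fin d) → ℕ) :
    Finset (Fin d → ℕ) :=
  U.biUnion fun u => termIndexSet (N u) u

/-- The inclusion `I_u ⊆ I(U)` for `u ∈ U`. -/
def incl {d : ℕ} {U : Finset (Finset (Fin d))} {N : Finset (Fin d) → ℕ} (u : U)
    (k : termIndexSet (N u) (u : Finset (Fin d))) : indexSet U N :=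
  ⟨k, Finset.mem_biUnion.2 ⟨u, u.2, k.2⟩⟩

/-- The system matrix `F(X, I(U)) = (T_k(x))_{x ∈ X, k ∈ I(U)}` for the nodes
`X = {x_1, …, x_M}`. -/
noncomputable def systemMatrix {d M : ℕ} (x : Fin M → Fin d → ℝ)
    (U : Finset (Finset (Fin d))) (N : Finset (Fin d) → ℕ) :
    Matrix (Fin M) (indexSet U N) ℝ :=
  Matrix.of fun j k => chebyshevT (k : Fin d → ℕ) (x j)

/-! ### The LSQR algorithm of Paige and Saunders -/

/-- The quantities that LSQR keeps between two iterations: the bidiagonalization vectors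
`u`, `v`, the search direction `w`, the approximate solution `x` and the scalars
`α`, `ρ̄`, `φ̄`. -/
structure LSQRState (m n : Type) where
  u : m → ℝ
  v : n → ℝ
  w : n → ℝ
  x : n → ℝ
  α : ℝ
  ρbar : ℝ
  φbar : ℝ

/-- The Euclidean norm of a real vector. -/
noncomputable def norm2 {m : Type} [Fintype m] (a : m → ℝ) : ℝ :=
  ‖(WithLp.toLp 2 a : EuclideanSpace ℝ m)‖

/-- Initialization of LSQR for `min ‖b - A h‖₂`:
`β u = b`, `α v = Aᵀ u`, `w = v`, `x = 0`, `φ̄ = β`, `ρ̄ = α`. -/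
noncomputable def lsqrInit {m n : Type} [Fintype m] [Fintype n]
    (A : Matrix m n ℝ) (b : m → ℝ) : LSQRState m n :=
  let β := norm2 b
  let u := β⁻¹ • b
  let p := A.transpose.mulVec u
  let α := norm2 p
  let v := α⁻¹ • p
  { u := u, v := v, w := v, x := 0, α := α, ρbar := α, φbar := β }

/-- One iteration of LSQR: continuation of the bidiagonalization, the next plane rotation,
and the update of `x` and `w`. The convention `0⁻¹ = 0` means that a vector that vanishes
is left as it is instead of being normalized. -/
noncomputable def lsqrStep {m n : Type} [Fintype m] [Fintype n]
    (A : Matrix m n ℝ) (s : LSQRState m n) : LSQRState m n :=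
  let q := A.mulVec s.v - s.α • s.u
  let β := norm2 q
  let u := β⁻¹ • q
  let p := A.transpose.mulVec u - β • s.v
  let α := norm2 p
  let v := α⁻¹ • p
  let ρ := Real.sqrt (s.ρbar ^ 2 + β ^ 2)
  let cs := s.ρbar / ρ
  let sn := β / ρ
  let θ := sn * α
  let φ := cs * s.φbar
  { u := u
    v := v
    w := v - (θ / ρ) • s.w
    x := s.x + (φ / ρ) • s.w
    α := α
    ρbar := -cs * α
    φbar := sn * s.φbar }

/-- The state of LSQR for `min ‖b - A h‖₂` after `i` iterations. -/
noncomputable def lsqrIterate {m n : Type} [Fintype m] [Fintype n]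
    (A : Matrix m n ℝ) (b : m → ℝ) : ℕ → LSQRState m n
  | 0 => lsqrInit A b
  | i + 1 => lsqrStep A (lsqrIterate A b i)

/-- Names of the real numbers that make up a state of LSQR. -/
inductive LSQRVar (m n : Type) : Type
  | u (j : m)
  | v (k : n)
  | w (k : n)
  | x (k : n)
  | α
  | ρbar
  | φbar

/-- The real numbers that make up a state of LSQR. -/
def LSQRState.vals {m n : Type} (s : LSQRState m n) : LSQRVar m n → ℝ
  | .u j => s.u j
  | .v k => s.v k
  | .w k => s.w k
  | .x k => s.x k
  | .α => s.α
  | .ρbar => s.ρbar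
  | .φbar => s.φbar

/-! ### Arithmetic programs -/

/-- An arithmetic instruction on real registers named by `R`: load a constant, or apply one
of `+, -, *, /, √` to registers; `out` is the register that receives the result. -/
inductive Instr (R : Type) : Type
  | const (c : ℝ) (out : R)
  | add (a b out : R)
  | sub (a b out : R)
  | mul (a b out : R)
  | div (a b out : R)
  | sqrt (a out : R)

open Classical in
/-- The effect of an instruction on the register contents. -/
noncomputable def Instr.exec {R : Type} (mem : R → ℝ) : Instr R → (R → ℝ)
  | .const c out => Function.update mem out c
  | .add a b out => Function.update mem out (mem a + mem b)
  | .sub a b out => Function.update mem out (mem a - mem b)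
  | .mul a b out => Function.update mem out (mem a * mem b)
  | .div a b out => Function.update mem out (mem a / mem b)
  | .sqrt a out => Function.update mem out (Real.sqrt (mem a))

/-- A straight-line arithmetic program with inputs named by `I` and outputs named by `O`.
Its registers are the input registers and the work registers `0, 1, 2, …`, which start
with the content `0`; the outputs are read off at the end from the registers `out`. -/
structure Program (I O : Type) where
  code : List (Instr (I ⊕ ℕ))
  out : O → I ⊕ ℕ

/-- The function computed by a program. -/
noncomputable def Program.eval {I O : Type} (P : Program I O) (a : I → ℝ) : O → ℝ :=
  fun o => P.code.foldl Instr.exec (Sum.elim a fun _ => 0) (P.out o)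

/-- The number of arithmetic operations of a program; loading a constant is counted too. -/
def Program.size {I O : Type} (P : Program I O) : ℕ := P.code.length

/-! ### Programs that call one transform per term -/

/-- For every term `u ∈ U`, a program for the multiplication of a vector of length `|I_u|`
with a matrix (`nfct`), and one for the adjoint multiplication of a vector of length `M`
(`adj`). -/
structure Transforms {d : ℕ} (M : ℕ) (U : Finset (Finset (Fin d)))
    (N : Finset (Fin d) → ℕ) where
  nfct : (u : U) → Program (termIndexSet (N u) (u : Finset (Fin d))) (Fin M)
  adj : (u : U) → Program (Fin M) (termIndexSet (N u) (u : Finset (Fin d)))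

/-- The transforms `t` are nonequispaced cosine transforms of accuracy `ε` for the nodes `x`,
realized by the matrix `G`: each entry of `G` differs by at most `ε` from that of the system
matrix `F = (F_u)_{u ∈ U}`, and, `G_u` being the block of `G` that belongs to `u`, the program
`nfct u` multiplies with `G_u` and the program `adj u` multiplies with its transpose. -/
structure Transforms.IsNFCT {d M : ℕ} {U : Finset (Finset (Fin d))}
    {N : Finset (Fin d) → ℕ} (t : Transforms M U N) (x : Fin M → Fin d → ℝ) (ε : ℝ)
    (G : Matrix (Fin M) (indexSet U N) ℝ) : Prop where
  accurate : ∀ j k, |G j k - systemMatrix x U N j k| ≤ ε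
  nfct_eval : ∀ (u : U) (h : termIndexSet (N u) (u : Finset (Fin d)) → ℝ),
    (t.nfct u).eval h = (G.submatrix id (incl u)).mulVec h
  adj_eval : ∀ (u : U) (f : Fin M → ℝ),
    (t.adj u).eval f = (G.submatrix id (incl u)).transpose.mulVec f

/-- An instruction of a program on registers `R` that may, besides arithmetic operations,
call the transforms: `args` are the registers that hold the argument of the transform, and
`outs` are the distinct registers that receive its result. -/
inductive CallInstr {d : ℕ} (M : ℕ) (U : Finset (Finset (Fin d)))
    (N : Finset (Fin d) → ℕ) (R : Type) : Type
  | op (i : Instr R)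
  | nfct (u : U) (args : termIndexSet (N u) (u : Finset (Fin d)) → R) (outs : Fin M ↪ R)
  | adj (u : U) (args : Fin M → R) (outs : termIndexSet (N u) (u : Finset (Fin d)) ↪ R)

section Calls

variable {d M : ℕ} {U : Finset (Finset (Fin d))} {N : Finset (Fin d) → ℕ} {R : Type}

/-- The effect of an instruction on the register contents. -/
noncomputable def CallInstr.exec (t : Transforms M U N) (mem : R → ℝ) :
    CallInstr M U N R → (R → ℝ)
  | .op i => i.exec mem
  | .nfct u args outs => Function.extend outs ((t.nfct u).eval fun k => mem (args k)) mem
  | .adj u args outs => Function.extend outs ((t.adj u).eval fun j => mem (args j)) mem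

/-- The number of arithmetic operations of an instruction; a call costs as many operations
as the called program performs. -/
def CallInstr.cost (t : Transforms M U N) : CallInstr M U N R → ℕ
  | .op _ => 1
  | .nfct u _ _ => (t.nfct u).size
  | .adj u _ _ => (t.adj u).size

/-- Whether the instruction is a call of the transform of the term `u`. -/
def CallInstr.callsNFCT (u : U) : CallInstr M U N R → Bool
  | .nfct v _ _ => decide (v = u)
  | _ => false

/-- Whether the instruction is a call of the adjoint transform of the term `u`. -/
def CallInstr.callsAdj (u : U) : CallInstr M U N R → Bool
  | .adj v _ _ => decide (v = u)
  | _ => false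

end Calls

/-- A straight-line program with inputs `I` and outputs `O` that may call the transforms. -/
structure CallProgram {d : ℕ} (M : ℕ) (U : Finset (Finset (Fin d)))
    (N : Finset (Fin d) → ℕ) (I O : Type) where
  code : List (CallInstr M U N (I ⊕ ℕ))
  out : O → I ⊕ ℕ

/-- The function computed by a program that calls the transforms `t`. -/
noncomputable def CallProgram.eval {d M : ℕ} {U : Finset (Finset (Fin d))}
    {N : Finset (Fin d) → ℕ} {I O : Type} (P : CallProgram M U N I O)
    (t : Transforms M U N) (a : I → ℝ) : O → ℝ :=
  fun o => P.code.foldl (CallInstr.exec t) (Sum.elim a fun _ => 0) (P.out o)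

/-- The total number of arithmetic operations, those of the called programs included. -/
def CallProgram.cost {d M : ℕ} {U : Finset (Finset (Fin d))}
    {N : Finset (Fin d) → ℕ} {I O : Type} (P : CallProgram M U N I O)
    (t : Transforms M U N) : ℕ :=
  (P.code.map (CallInstr.cost t)).sum

/-! ### LSQR with grouped transforms -/

/-- The program `P`, calling the transforms `t` for the nodes `x`, performs the iterations of
LSQR for the least-squares problem `min ‖W y - W F h‖₂`, `W = diag(w)`, `F = F(x, I(U))`,
in which multiplications with `F` and `Fᵀ` are realized by the transforms, i.e. by the matrix
`G` and its transpose: for all data `y` and all `i` it takes the state after `i` iterations to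
the state after `i + 1` iterations. In one iteration the transform and the adjoint transform
of each term are called exactly once. -/
structure PerformsLSQR {d M : ℕ} {U : Finset (Finset (Fin d))} {N : Finset (Fin d) → ℕ}
    (P : CallProgram M U N (LSQRVar (Fin M) (indexSet U N)) (LSQRVar (Fin M) (indexSet U N)))
    (t : Transforms M U N) (w : Fin M → ℝ) (G : Matrix (Fin M) (indexSet U N) ℝ) :
    Prop where
  eval_iterate : ∀ (y : Fin M → ℝ) (i : ℕ),
    P.eval t (lsqrIterate (Matrix.diagonal w * G) ((Matrix.diagonal w).mulVec y) i).vals =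
      (lsqrIterate (Matrix.diagonal w * G) ((Matrix.diagonal w).mulVec y) (i + 1)).vals
  nfct_once : ∀ u : U, P.code.countP (CallInstr.callsNFCT u) = 1
  adj_once : ∀ u : U, P.code.countP (CallInstr.callsAdj u) = 1

/-- LSQR for `min ‖W y - W F(x, I(U)) h‖₂`, `W = diag(w)`, with transforms of accuracy `ε`
can be carried out such that each NFCT and each adjoint NFCT takes at most
`C (N_u ^ |u| log N_u + |X|)` and each iteration of LSQR takes at most
`C (∑_{u ∈ U} N_u ^ |u| log N_u + |X| |U|)` arithmetic operations. -/
def FastLSQR {d M : ℕ} (C ε : ℝ) (x : Fin M → Fin d → ℝ) (w : Fin M → ℝ)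
    (U : Finset (Finset (Fin d))) (N : Finset (Fin d) → ℕ) : Prop :=
  ∃ (t : Transforms M U N) (G : Matrix (Fin M) (indexSet U N) ℝ)
    (P : CallProgram M U N
      (LSQRVar (Fin M) (indexSet U N)) (LSQRVar (Fin M) (indexSet U N))),
    t.IsNFCT x ε G ∧ PerformsLSQR P t w G ∧
    (∀ u : U,
      ((t.nfct u).size : ℝ) ≤
        C * ((N u : ℝ) ^ (u : Finset (Fin d)).card * Real.log (N u) + M) ∧
      ((t.adj u).size : ℝ) ≤
        C * ((N u : ℝ) ^ (u : Finset (Fin d)).card * Real.log (N u) + M)) ∧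
    (P.cost t : ℝ) ≤
      C * (∑ u ∈ U, (N u : ℝ) ^ u.card * Real.log (N u) + (M : ℝ) * (U.card : ℝ))

end GroupedLSQR

/-!
The nodes are moved to a grid on which a classical fast transform is available. With
`x_s = cos t_s`, the entry `T_k(x)` is `√2 ^ |u|` times the product of the `cos (k_s t_s)`, `s ∈ u`,
`u = supp k`. Round each `t_s` down to the grid `2 π l / L`, where `L` is a power of two between
`2 ^ κ N_u` and `2 ^ (κ + 1) N_u`. Since cosine is 1-Lipschitz and `k_s ≤ N_u`, this changes the
entry by at most `√2 ^ |u| |u| 2 π / 2 ^ κ`, which is at most `ε` if `κ` is large in dependence of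
`ds` and `ε` only (`abs_roundedMatrix_sub_le`). The resulting matrix `roundedMatrix` plays the
role of `G`.

A block of `G` is `√2 ^ |u|` times a submatrix, possibly with repeated rows, of the `|u|`-fold
tensor product of the matrix `(cos (2 π k l / L))`. Multiplication with it pads the input by zeros,
performs the transform on the full grid and reads off values. The kernel being symmetric, the
adjoint accumulates the input at the grid points and otherwise does the same; both are instances
of `exists_program_cosKernel`. The full transform is a radix-2 fast Fourier transform for the
cosine and sine sums in one variable (`derives_cosSum_sinSum`), applied in one direction after
the other (`derives_cosKernel`). It takes `O(L ^ |u| log L)` operations, and `L` is `N_u` up to a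
constant; for `N_u = 1`, where the logarithm vanishes, the constant number of operations is
covered by the summand `|X| ≥ 1`.

An iteration of LSQR consists of one multiplication with each block, one with each transposed
block, and `O(|X| |U| + |I(U)|)` further operations (`realizes_lsqrStep`).

Programs are not written down register by register. The relation `Derives c V W` between sets
of functions of the input says that `c` operations lead from `V` to `W`; it composes without any
bookkeeping of registers and is turned into code by `Derives.exists_code`. `Realizes` is the
analogue for code that also calls transforms.
-/

namespace GroupedLSQR

/-! ### Straight-line derivations of real functions -/

/-- `Op V f`: one arithmetic operation applied to functions in `V` yields `f`. -/
inductive Op {A : Type} (V : Set (A → ℝ)) : (A → ℝ) → Prop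
  | const (c : ℝ) : Op V fun _ => c
  | add {f g : A → ℝ} : f ∈ V → g ∈ V → Op V (f + g)
  | sub {f g : A → ℝ} : f ∈ V → g ∈ V → Op V (f - g)
  | mul {f g : A → ℝ} : f ∈ V → g ∈ V → Op V (f * g)
  | div {f g : A → ℝ} : f ∈ V → g ∈ V → Op V (f / g)
  | sqrt {f : A → ℝ} : f ∈ V → Op V fun a => Real.sqrt (f a)

/-- `Derives c V W`: all functions in `W` are obtained from those in `V` by `c` successive
arithmetic operations. The functions stand for the register contents in dependence of the
input `a : A`; registers themselves do not occur, so derivations need no renaming when they are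
put together. -/
inductive Derives {A : Type} : ℕ → Set (A → ℝ) → Set (A → ℝ) → Prop
  | done {V W : Set (A → ℝ)} : W ⊆ V → Derives 0 V W
  | step {c : ℕ} {V W : Set (A → ℝ)} {f : A → ℝ} :
      Op V f → Derives c (insert f V) W → Derives (c + 1) V W

section Derives

variable {A : Type} {V V' W W' : Set (A → ℝ)} {f g : A → ℝ} {c c' : ℕ}

theorem Op.mono (h : Op V f) (hV : V ⊆ V') : Op V' f := by
  cases h with
  | const c => exact .const c
  | add h1 h2 => exact .add (hV h1) (hV h2)
  | sub h1 h2 => exact .sub (hV h1) (hV h2)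
  | mul h1 h2 => exact .mul (hV h1) (hV h2)
  | div h1 h2 => exact .div (hV h1) (hV h2)
  | sqrt h1 => exact .sqrt (hV h1)

theorem Derives.mono_left (h : Derives c V W) (hV : V ⊆ V') : Derives c V' W := by
  induction h generalizing V' with
  | done h => exact .done (h.trans hV)
  | step ho _ ih => exact .step (ho.mono hV) (ih (Set.insert_subset_insert hV))

theorem Derives.mono_right (h : Derives c V W) (hW : W' ⊆ W) : Derives c V W' := by
  induction h with
  | done h => exact .done (hW.trans h)
  | step ho _ ih => exact .step ho (ih hW)

theorem Derives.succ (h : Derives c V W) : Derives (c + 1) V W :=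
  .step (.const 0) (h.mono_left (Set.subset_insert _ _))

theorem Derives.mono_cost (h : Derives c V W) (hc : c ≤ c') : Derives c' V W := by
  induction hc with
  | refl => exact h
  | step _ ih => exact ih.succ

theorem Derives.trans (h : Derives c V W) (h' : Derives c' (V ∪ W) W') :
    Derives (c + c') V W' := by
  induction h with
  | done h =>
    rw [Nat.zero_add]
    exact h'.mono_left (Set.union_subset subset_rfl h)
  | @step c V W f ho _ ih =>
    rw [Nat.add_right_comm]
    exact .step ho (ih (h'.mono_left (Set.union_subset_union_left _ (Set.subset_insert _ _))))

theorem Derives.comp (h : Derives c V W) (h' : Derives c' W W') : Derives (c + c') V W' :=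
  h.trans (h'.mono_left Set.subset_union_right)

theorem Derives.keep (h : Derives c V W) : Derives c V (V ∪ W) := by
  simpa using h.trans (.done subset_rfl)

theorem Derives.union (h : Derives c V W) (h' : Derives c' V W') :
    Derives (c + c') V (W ∪ W') := by
  refine h.trans ?_
  refine (h'.mono_left Set.subset_union_left).keep.mono_right ?_
  exact Set.union_subset_union_left _ Set.subset_union_right

theorem Derives.biUnion {ι : Type*} (s : Finset ι) {W : ι → Set (A → ℝ)}
    (h : ∀ i ∈ s, Derives c V (W i)) : Derives (s.card * c) V (⋃ i ∈ s, W i) := by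
  classical
  induction s using Finset.induction_on with
  | empty => simpa using Derives.done (Set.empty_subset V)
  | insert i s hi ih =>
    rw [Finset.card_insert_of_notMem hi, Finset.set_biUnion_insert, Nat.succ_mul, Nat.add_comm]
    exact (h i (Finset.mem_insert_self i s)).union
      (ih fun j hj => h j (Finset.mem_insert_of_mem hj))

theorem Derives.range {ι : Type*} [Fintype ι] {f : ι → A → ℝ}
    (h : ∀ i, Derives c V {f i}) : Derives (Fintype.card ι * c) V (Set.range f) := by
  refine (Derives.biUnion Finset.univ fun i _ => h i).mono_right ?_
  rintro _ ⟨i, rfl⟩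
  simp

theorem Op.derives (h : Op V f) : Derives 1 V {f} := .step h (.done (by simp))

theorem Derives.smul (r : ℝ) (hf : f ∈ V) : Derives 2 V {r • f} :=
  .step (.const r) (.step (.mul (Set.mem_insert _ _) (Set.mem_insert_of_mem _ hf))
    (.done (by rintro _ rfl; exact Or.inl rfl)))

theorem Derives.linComb (a b : ℝ) (hf : f ∈ V) (hg : g ∈ V) :
    Derives 5 V {a • f + b • g} :=
  ((Derives.smul a hf).union (Derives.smul b hg)).trans (Op.derives (.add (by simp) (by simp)))

theorem Derives.addLinComb {e : A → ℝ} (a b : ℝ) (he : e ∈ V) (hf : f ∈ V) (hg : g ∈ V) :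
    Derives 6 V {e + (a • f + b • g)} :=
  (Derives.linComb a b hf hg).trans (Op.derives (.add (Or.inl he) (by simp)))

/-- The summands are formed one at a time, by `n` operations each, and added to the sum. -/
theorem Derives.sum {ι : Type*} {n : ℕ} (s : Finset ι) {f : ι → A → ℝ}
    (h : ∀ i ∈ s, Derives n V {f i}) : Derives (s.card * (n + 1) + 1) V {∑ i ∈ s, f i} := by
  classical
  induction s using Finset.induction_on with
  | empty =>
    rw [Finset.card_empty, Finset.sum_empty, Nat.zero_mul]
    exact Op.derives (.const 0)
  | insert i s hi ih =>
    rw [Finset.card_insert_of_notMem hi, Finset.sum_insert hi]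
    have h2 := ih fun j hj => h j (Finset.mem_insert_of_mem hj)
    refine (((h i (Finset.mem_insert_self i s)).union h2).trans
      (Op.derives (.add ?_ ?_))).mono_cost (le_of_eq (by ring))
    · simp
    · simp

end Derives

/-! ### The fast cosine transform -/

section FFT

variable {A : Type}

/-- The angle `2 π k l / 2 ^ p`. -/
noncomputable def gridAngle (p k l : ℕ) : ℝ := 2 * Real.pi * (k * l) / 2 ^ p

theorem gridAngle_comm (p k l : ℕ) : gridAngle p k l = gridAngle p l k := by
  unfold gridAngle
  ring

theorem gridAngle_eq_mod_add (p k l : ℕ) :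
    gridAngle p k l = gridAngle p k (l % 2 ^ p) + (k * (l / 2 ^ p) : ℕ) * (2 * Real.pi) := by
  have h : (l : ℝ) = (l % 2 ^ p : ℕ) + 2 ^ p * (l / 2 ^ p : ℕ) := by
    exact_mod_cast (Nat.mod_add_div l (2 ^ p)).symm
  unfold gridAngle
  rw [h]
  generalize (l % 2 ^ p : ℕ) = r
  generalize (l / 2 ^ p : ℕ) = q
  push_cast
  field_simp

theorem cos_gridAngle_mod (p k l : ℕ) :
    Real.cos (gridAngle p k (l % 2 ^ p)) = Real.cos (gridAngle p k l) := by
  rw [gridAngle_eq_mod_add p k l, Real.cos_add_nat_mul_two_pi]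

theorem sin_gridAngle_mod (p k l : ℕ) :
    Real.sin (gridAngle p k (l % 2 ^ p)) = Real.sin (gridAngle p k l) := by
  rw [gridAngle_eq_mod_add p k l, Real.sin_add_nat_mul_two_pi]

theorem gridAngle_two_mul (p k l : ℕ) : gridAngle (p + 1) (2 * k) l = gridAngle p k l := by
  unfold gridAngle
  push_cast
  rw [pow_succ]
  field_simp

theorem gridAngle_two_mul_add_one (p k l : ℕ) :
    gridAngle (p + 1) (2 * k + 1) l = gridAngle p k l + gridAngle (p + 1) 1 l := by
  unfold gridAngle
  push_cast
  rw [pow_succ]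
  field_simp

/-- The cosine sum of length `2 ^ p` of the family `f` at the `l`-th grid point. -/
noncomputable def cosSum (p : ℕ) (f : ℕ → A → ℝ) (l : ℕ) : A → ℝ :=
  ∑ k ∈ Finset.range (2 ^ p), Real.cos (gridAngle p k l) • f k

/-- The sine sum of length `2 ^ p` of the family `f` at the `l`-th grid point. -/
noncomputable def sinSum (p : ℕ) (f : ℕ → A → ℝ) (l : ℕ) : A → ℝ :=
  ∑ k ∈ Finset.range (2 ^ p), Real.sin (gridAngle p k l) • f k

theorem sum_range_two_mul {E : Type*} [AddCommMonoid E] (n : ℕ) (g : ℕ → E) :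
    ∑ k ∈ Finset.range (2 * n), g k =
      ∑ k ∈ Finset.range n, g (2 * k) + ∑ k ∈ Finset.range n, g (2 * k + 1) := by
  induction n with
  | zero => simp
  | succ n ih =>
    rw [Nat.mul_succ, Finset.sum_range_succ, Finset.sum_range_succ, ih,
      Finset.sum_range_succ, Finset.sum_range_succ]
    abel

theorem cosSum_succ (p : ℕ) (f : ℕ → A → ℝ) (l : ℕ) :
    cosSum (p + 1) f l = cosSum p (fun k => f (2 * k)) l +
      (Real.cos (gridAngle (p + 1) 1 l) • cosSum p (fun k => f (2 * k + 1)) l +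
        (-Real.sin (gridAngle (p + 1) 1 l)) • sinSum p (fun k => f (2 * k + 1)) l) := by
  unfold cosSum sinSum
  rw [pow_succ', sum_range_two_mul]
  simp only [gridAngle_two_mul, gridAngle_two_mul_add_one, Finset.smul_sum, Real.cos_add,
    ← Finset.sum_add_distrib, smul_smul]
  refine Finset.sum_congr rfl fun k _ => ?_
  ext a
  simp only [Pi.add_apply, Pi.smul_apply, smul_eq_mul]
  ring

theorem sinSum_succ (p : ℕ) (f : ℕ → A → ℝ) (l : ℕ) :
    sinSum (p + 1) f l = sinSum p (fun k => f (2 * k)) l +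
      (Real.cos (gridAngle (p + 1) 1 l) • sinSum p (fun k => f (2 * k + 1)) l +
        Real.sin (gridAngle (p + 1) 1 l) • cosSum p (fun k => f (2 * k + 1)) l) := by
  unfold cosSum sinSum
  rw [pow_succ', sum_range_two_mul]
  simp only [gridAngle_two_mul, gridAngle_two_mul_add_one, Finset.smul_sum, Real.sin_add,
    ← Finset.sum_add_distrib, smul_smul]
  refine Finset.sum_congr rfl fun k _ => ?_
  ext a
  simp only [Pi.add_apply, Pi.smul_apply, smul_eq_mul]
  ring

theorem cosSum_mod (p : ℕ) (f : ℕ → A → ℝ) (l : ℕ) :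
    cosSum p f (l % 2 ^ p) = cosSum p f l := by
  simp only [cosSum, cos_gridAngle_mod]

theorem sinSum_mod (p : ℕ) (f : ℕ → A → ℝ) (l : ℕ) :
    sinSum p f (l % 2 ^ p) = sinSum p f l := by
  simp only [sinSum, sin_gridAngle_mod]

/-- The radix-2 fast Fourier transform in real arithmetic: the cosine and sine sums of length
`2 ^ (p + 1)` are combined from those of the even and of the odd half, by 12 operations
per grid point. -/
theorem derives_cosSum_sinSum (p : ℕ) (f : ℕ → A → ℝ) :
    Derives (2 ^ p * (12 * (p + 1))) (f '' Set.Iio (2 ^ p))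
      (Set.range (cosSum p f) ∪ Set.range (sinSum p f)) := by
  induction p generalizing f with
  | zero =>
    have h : Derives 1 (f '' Set.Iio (2 ^ 0)) {(fun _ => 0 : A → ℝ)} := Op.derives (.const 0)
    refine (h.keep.mono_right ?_).mono_cost (by norm_num)
    rintro _ (⟨l, rfl⟩ | ⟨l, rfl⟩)
    · exact Or.inl ⟨0, by simp, by simp [cosSum, gridAngle]⟩
    · exact Or.inr (by ext; simp [sinSum, gridAngle])
  | succ p ih =>
    set V := f '' Set.Iio (2 ^ (p + 1))
    have he := (ih fun k => f (2 * k)).mono_left (V' := V) (by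
      rintro _ ⟨k, hk, rfl⟩
      exact ⟨2 * k, by simp only [Set.mem_Iio, pow_succ] at *; omega, rfl⟩)
    have ho := (ih fun k => f (2 * k + 1)).mono_left (V' := V) (by
      rintro _ ⟨k, hk, rfl⟩
      exact ⟨2 * k + 1, by simp only [Set.mem_Iio, pow_succ] at *; omega, rfl⟩)
    refine ((he.union ho).trans (((Derives.biUnion (c := 12) (Finset.range (2 ^ (p + 1)))
      (W := fun l => {cosSum (p + 1) f l} ∪ {sinSum (p + 1) f l})
      fun l _ => ?_)).mono_right ?_)).mono_cost (le_of_eq ?_)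
    · refine Derives.union (c := 6) (c' := 6) ?_ ?_
      · rw [cosSum_succ]
        exact .addLinComb _ _ (by simp) (by simp) (by simp)
      · rw [sinSum_succ]
        exact .addLinComb _ _ (by simp) (by simp) (by simp)
    · have hlt : ∀ l, l % 2 ^ (p + 1) < 2 ^ (p + 1) := fun l => Nat.mod_lt _ (by positivity)
      rintro _ (⟨l, rfl⟩ | ⟨l, rfl⟩)
      · exact Set.mem_biUnion (Finset.mem_range.2 (hlt l)) (Or.inl (cosSum_mod _ _ _).symm)
      · exact Set.mem_biUnion (Finset.mem_range.2 (hlt l)) (Or.inr (sinSum_mod _ _ _).symm)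
    · rw [Finset.card_range]
      ring

variable {ι : Type*}

/-- The entry at `k`, `l` of the tensor product cosine transform in the directions `u`. -/
noncomputable def cosKernel (p : ℕ) (u : Finset ι) (k l : ι → ℕ) : ℝ :=
  ∏ s ∈ u, Real.cos (gridAngle p (k s) (l s))

theorem cosKernel_comm (p : ℕ) (u : Finset ι) (k l : ι → ℕ) :
    cosKernel p u k l = cosKernel p u l k := by
  simp only [cosKernel, gridAngle_comm]

variable [DecidableEq ι]

theorem cosKernel_insert_update (p : ℕ) {u : Finset ι} {s : ι} (hs : s ∉ u) (k l : ι → ℕ)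
    (m : ℕ) : cosKernel p (insert s u) (Function.update k s m) l =
      Real.cos (gridAngle p m (l s)) * cosKernel p u k (Function.update l s 0) := by
  unfold cosKernel
  rw [Finset.prod_insert hs, Function.update_self]
  congr 1
  refine Finset.prod_congr rfl fun r hr => ?_
  have h : r ≠ s := fun h => hs (h ▸ hr)
  simp [h]

variable [Fintype ι]

/-- The integer points with coordinates below `n` in the directions `u`, and `0` in the
others. -/
def grid (n : ℕ) (u : Finset ι) : Finset (ι → ℕ) :=
  Fintype.piFinset fun s => if s ∈ u then Finset.range n else {0}

theorem mem_grid {n : ℕ} {u : Finset ι} {k : ι → ℕ} :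
    k ∈ grid n u ↔ (∀ s ∈ u, k s < n) ∧ ∀ s ∉ u, k s = 0 := by
  simp only [grid, Fintype.mem_piFinset]
  constructor
  · exact fun h => ⟨fun s hs => by simpa [hs] using h s, fun s hs => by simpa [hs] using h s⟩
  · rintro ⟨h1, h2⟩ s
    by_cases hs : s ∈ u
    · simpa [hs] using h1 s hs
    · simpa [hs] using h2 s hs

theorem card_grid (n : ℕ) (u : Finset ι) : (grid n u).card = n ^ u.card := by
  simp [grid, Fintype.card_piFinset, apply_ite Finset.card]

theorem update_mem_grid_insert {n : ℕ} {u : Finset ι} {s : ι} {k : ι → ℕ} {m : ℕ}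
    (hk : k ∈ grid n u) (hm : m < n) : Function.update k s m ∈ grid n (insert s u) := by
  rw [mem_grid] at *
  refine ⟨fun r hr => ?_, fun r hr => ?_⟩
  · by_cases h : r = s
    · simpa [h] using hm
    · simpa [h] using hk.1 r (Finset.mem_of_mem_insert_of_ne hr h)
  · rw [Finset.mem_insert, not_or] at hr
    simpa [hr.1] using hk.2 r hr.2

theorem update_zero_mem_grid {n : ℕ} {u : Finset ι} {s : ι} (hs : s ∉ u) {k : ι → ℕ}
    (hk : k ∈ grid n (insert s u)) : Function.update k s 0 ∈ grid n u := by
  rw [mem_grid] at *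
  refine ⟨fun r hr => ?_, fun r hr => ?_⟩
  · have h : r ≠ s := fun h => hs (h ▸ hr)
    simpa [h] using hk.1 r (Finset.mem_insert_of_mem hr)
  · by_cases h : r = s
    · simp [h]
    · simpa [h] using hk.2 r (by simp [h, hr])

theorem sum_grid_insert {E : Type*} [AddCommMonoid E] (n : ℕ) {u : Finset ι} {s : ι}
    (hs : s ∉ u) (g : (ι → ℕ) → E) :
    ∑ k ∈ grid n (insert s u), g k =
      ∑ m ∈ Finset.range n, ∑ k ∈ grid n u, g (Function.update k s m) := by
  rw [← Finset.sum_product']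
  symm
  refine Finset.sum_nbij' (fun q => Function.update q.2 s q.1)
    (fun k => (k s, Function.update k s 0)) ?_ ?_ ?_ ?_ ?_
  · rintro ⟨m, k⟩ h
    rw [Finset.mem_product, Finset.mem_range] at h
    exact update_mem_grid_insert h.2 h.1
  · intro k hk
    rw [Finset.mem_product, Finset.mem_range]
    exact ⟨(mem_grid.1 hk).1 s (Finset.mem_insert_self s u), update_zero_mem_grid hs hk⟩
  · rintro ⟨m, k⟩ h
    rw [Finset.mem_product] at h
    have h0 := (mem_grid.1 h.2).2 s hs
    simp [← h0]
  · intro k _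
    simp
  · intro q _
    rfl

/-- The multivariate transform on the full grid is carried out one direction after the other,
the one-dimensional transform being applied on each line of the grid. -/
theorem derives_cosKernel (p : ℕ) (u : Finset ι) (f : (ι → ℕ) → A → ℝ) :
    Derives (u.card * (2 ^ p) ^ u.card * (12 * (p + 1))) (f '' grid (2 ^ p) u)
      ((fun l => ∑ k ∈ grid (2 ^ p) u, cosKernel p u k l • f k) '' grid (2 ^ p) u) := by
  induction u using Finset.induction_on generalizing f with
  | empty =>
    have h : grid (2 ^ p) (∅ : Finset ι) = {0} := by ext k; simp [mem_grid, funext_iff]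
    refine (Derives.done ?_).mono_cost (Nat.zero_le _)
    simp [h, cosKernel]
  | insert s u hs ih =>
    have h1 := Derives.biUnion (Finset.range (2 ^ p)) fun m hm =>
      (ih fun k => f (Function.update k s m)).mono_left (V' := f '' grid (2 ^ p) (insert s u)) (by
        rintro _ ⟨k, hk, rfl⟩
        exact ⟨_, update_mem_grid_insert hk (Finset.mem_range.1 hm), rfl⟩)
    have h2 := Derives.biUnion (grid (2 ^ p) u) fun l hl =>
      (derives_cosSum_sinSum p fun m =>
        ∑ k ∈ grid (2 ^ p) u, cosKernel p u k l • f (Function.update k s m)).mono_left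
          (V' := f '' grid (2 ^ p) (insert s u) ∪ ⋃ m ∈ Finset.range (2 ^ p),
            (fun l => ∑ k ∈ grid (2 ^ p) u, cosKernel p u k l • f (Function.update k s m)) ''
              grid (2 ^ p) u) (by
        rintro _ ⟨m, hm, rfl⟩
        exact Or.inr (Set.mem_biUnion (Finset.mem_range.2 hm) ⟨l, hl, rfl⟩))
    refine (h1.trans (h2.mono_right ?_)).mono_cost (le_of_eq ?_)
    · rintro _ ⟨l, hl, rfl⟩
      refine Set.mem_biUnion (update_zero_mem_grid hs hl) (Or.inl ⟨l s, ?_⟩)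
      simp only [cosSum, sum_grid_insert _ hs, Finset.smul_sum, cosKernel_insert_update _ hs,
        smul_smul]
    · rw [Finset.card_range, card_grid, Finset.card_insert_of_notMem hs]
      ring

end FFT

/-! ### From derivations to programs -/

section Code

variable {A I : Type} {V W : Set (A → ℝ)} {n : ℕ}

/-- `Holds mem n V`: in the memory `mem`, which depends on the input `a : A`, each function of
`V` is the content of an input register or of one of the first `n` work registers. -/
def Holds (mem : A → I ⊕ ℕ → ℝ) (n : ℕ) (V : Set (A → ℝ)) : Prop :=
  ∀ f ∈ V, ∃ r, (∀ m, r = Sum.inr m → m < n) ∧ ∀ a, mem a r = f a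

theorem holds_inputs (n : ℕ) :
    Holds (fun a : I → ℝ => Sum.elim a fun _ => (0 : ℝ)) n (Set.range fun i a => a i) := by
  rintro _ ⟨i, rfl⟩
  exact ⟨.inl i, by simp, fun a => rfl⟩

theorem Holds.update [DecidableEq (I ⊕ ℕ)] {mem : A → I ⊕ ℕ → ℝ} (h : Holds mem n V) (f : A → ℝ) :
    Holds (fun a => Function.update (mem a) (.inr n) (f a)) (n + 1) (insert f V) := by
  rintro g (rfl | hg)
  · exact ⟨.inr n, by simp, fun a => by simp⟩
  · obtain ⟨r, hr, hm⟩ := h g hg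
    refine ⟨r, fun m e => (hr m e).trans n.lt_succ_self, fun a => ?_⟩
    have hne : r ≠ .inr n := fun e => lt_irrefl n (hr n e)
    simp [hne, hm]

theorem Op.exists_instr {mem : A → I ⊕ ℕ → ℝ} {f : A → ℝ} (h : Op V f) (hm : Holds mem n V) :
    ∃ i : Instr (I ⊕ ℕ), Holds (fun a => i.exec (mem a)) (n + 1) (insert f V) := by
  let _ : DecidableEq (I ⊕ ℕ) := fun _ _ => Classical.propDecidable _
  have hu := hm.update f
  cases h with
  | const c => exact ⟨.const c (.inr n), hu⟩
  | add hf hg =>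
    obtain ⟨r, -, hr⟩ := hm _ hf
    obtain ⟨s, -, hs⟩ := hm _ hg
    exact ⟨.add r s (.inr n), by simp only [Instr.exec, hr, hs]; exact hu⟩
  | sub hf hg =>
    obtain ⟨r, -, hr⟩ := hm _ hf
    obtain ⟨s, -, hs⟩ := hm _ hg
    exact ⟨.sub r s (.inr n), by simp only [Instr.exec, hr, hs]; exact hu⟩
  | mul hf hg =>
    obtain ⟨r, -, hr⟩ := hm _ hf
    obtain ⟨s, -, hs⟩ := hm _ hg
    exact ⟨.mul r s (.inr n), by simp only [Instr.exec, hr, hs]; exact hu⟩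
  | div hf hg =>
    obtain ⟨r, -, hr⟩ := hm _ hf
    obtain ⟨s, -, hs⟩ := hm _ hg
    exact ⟨.div r s (.inr n), by simp only [Instr.exec, hr, hs]; exact hu⟩
  | sqrt hf =>
    obtain ⟨r, -, hr⟩ := hm _ hf
    exact ⟨.sqrt r (.inr n), by simp only [Instr.exec, hr]; exact hu⟩

theorem Derives.exists_code {c : ℕ} {mem : A → I ⊕ ℕ → ℝ} (h : Derives c V W)
    (hm : Holds mem n V) : ∃ code : List (Instr (I ⊕ ℕ)), code.length = c ∧
      ∃ n', Holds (fun a => code.foldl Instr.exec (mem a)) n' W := by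
  induction h generalizing mem n with
  | done hW => exact ⟨[], rfl, n, fun f hf => hm f (hW hf)⟩
  | step ho _ ih =>
    obtain ⟨i, hi⟩ := ho.exists_instr hm
    obtain ⟨code, hlen, n', hn'⟩ := ih hi
    exact ⟨i :: code, by simp [hlen], n', hn'⟩

theorem Derives.exists_program {O : Type} {c : ℕ} {W : Set ((I → ℝ) → ℝ)}
    (h : Derives c (Set.range fun i a => a i) W) {f : O → (I → ℝ) → ℝ} (hf : ∀ o, f o ∈ W) :
    ∃ P : Program I O, P.size = c ∧ ∀ a o, P.eval a o = f o a := by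
  obtain ⟨code, hlen, n, hn⟩ := h.exists_code (holds_inputs 0)
  choose out _ hout using fun o => hn (f o) (hf o)
  exact ⟨⟨code, out⟩, hlen, fun a o => hout o a⟩

end Code

/-! ### Fast multiplication with a sampled cosine matrix -/

/-- Multiplication with a matrix whose entries are those of the tensor product cosine transform
at positions `π j`, `τ o` of the grid: the inputs are accumulated at the grid points `π j`, the
transform on the full grid follows, and its values at the points `τ o` are read off. -/
theorem exists_program_cosKernel {ι J O : Type} [DecidableEq ι] [Fintype ι] [Fintype J]
    (p : ℕ) (u : Finset ι) (c : ℝ) (π : J → ι → ℕ) (τ : O → ι → ℕ)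
    (hπ : ∀ j, π j ∈ grid (2 ^ p) u) (hτ : ∀ o, τ o ∈ grid (2 ^ p) u) :
    ∃ P : Program J O,
      P.size = 3 * Fintype.card J + (2 ^ p) ^ u.card +
        u.card * (2 ^ p) ^ u.card * (12 * (p + 1)) ∧
      ∀ a o, P.eval a o = ∑ j, c * cosKernel p u (π j) (τ o) * a j := by
  classical
  set V : Set ((J → ℝ) → ℝ) := Set.range fun j a => a j
  set b : (ι → ℕ) → (J → ℝ) → ℝ := fun g =>
    ∑ j ∈ Finset.univ.filter (fun j => π j = g), c • fun a : J → ℝ => a j with hb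
  have h1 : Derives (3 * Fintype.card J + (2 ^ p) ^ u.card) V (b '' grid (2 ^ p) u) := by
    have h : ∀ s : Finset (ι → ℕ), Derives
        (∑ g ∈ s, ((Finset.univ.filter fun j => π j = g).card * (2 + 1) + 1)) V (b '' s) := by
      intro s
      induction s using Finset.induction_on with
      | empty => simpa using Derives.done (Set.empty_subset V)
      | insert g s hg ih =>
        rw [Finset.sum_insert hg, Finset.coe_insert, Set.image_insert_eq, Set.insert_eq]
        exact (Derives.sum _ fun j _ => Derives.smul c (Set.mem_range_self j)).union ih
    refine (h (grid (2 ^ p) u)).mono_cost (le_of_eq ?_)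
    rw [Finset.sum_add_distrib, ← Finset.sum_mul,
      ← Finset.card_eq_sum_card_fiberwise fun j _ => hπ j, Finset.card_univ, Finset.sum_const,
      card_grid, smul_eq_mul, mul_one, mul_comm]
  have h2 := h1.trans ((derives_cosKernel p u b).mono_left Set.subset_union_right)
  obtain ⟨P, hP, he⟩ := h2.exists_program fun o => Set.mem_image_of_mem _ (hτ o)
  refine ⟨P, hP, fun a o => ?_⟩
  rw [he, Finset.sum_apply, ← Finset.sum_fiberwise_of_maps_to fun j _ => hπ j]
  refine Finset.sum_congr rfl fun g _ => ?_
  simp only [hb, Pi.smul_apply, Finset.sum_apply, smul_eq_mul, Finset.mul_sum]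
  refine Finset.sum_congr rfl fun j hj => ?_
  rw [(Finset.mem_filter.1 hj).2]
  ring

/-! ### Programs with calls -/

section Calls

variable {d M : ℕ} {U : Finset (Finset (Fin d))} {N : Finset (Fin d) → ℕ} {A I : Type}

/-- `Realizes I t p q c V W`: whatever registers hold the functions `V`, there is code of cost
`c` that makes the functions `W` available and that calls the transform of the term `u` exactly
`p u` times, and its adjoint exactly `q u` times. -/
def Realizes (I : Type) (t : Transforms M U N) (p q : U → ℕ) (c : ℕ) (V W : Set (A → ℝ)) :
    Prop :=
  ∀ (mem : A → I ⊕ ℕ → ℝ) (n : ℕ), Holds mem n V →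
    ∃ code : List (CallInstr M U N (I ⊕ ℕ)),
      (∃ n', Holds (fun a => code.foldl (CallInstr.exec t) (mem a)) n' W) ∧
      (∀ u, code.countP (CallInstr.callsNFCT u) = p u) ∧
      (∀ u, code.countP (CallInstr.callsAdj u) = q u) ∧
      (code.map (CallInstr.cost t)).sum = c

variable {t : Transforms M U N} {p q p' q' : U → ℕ} {c c' : ℕ} {V W X : Set (A → ℝ)}

theorem Realizes.trans (h : Realizes I t p q c V W) (h' : Realizes I t p' q' c' W X) :
    Realizes I t (p + p') (q + q') (c + c') V X := by
  intro mem n hm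
  obtain ⟨code, ⟨n', hn'⟩, hp, hq, hc⟩ := h mem n hm
  obtain ⟨code', ⟨n'', hn''⟩, hp', hq', hc'⟩ := h' _ n' hn'
  refine ⟨code ++ code', ⟨n'', ?_⟩, ?_, ?_, ?_⟩
  · simpa only [List.foldl_append] using hn''
  · simp [hp, hp']
  · simp [hq, hq']
  · simp [hc, hc']

theorem Realizes.refl : Realizes I t 0 0 0 V V :=
  fun _ n hm => ⟨[], ⟨n, hm⟩, by simp, by simp, rfl⟩

theorem Realizes.mono (h : Realizes I t p q c V W) (hX : X ⊆ W) : Realizes I t p q c V X := by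
  intro mem n hm
  obtain ⟨code, ⟨n', hn'⟩, hr⟩ := h mem n hm
  exact ⟨code, ⟨n', fun f hf => hn' f (hX hf)⟩, hr⟩

theorem Derives.realizes (h : Derives c V W) : Realizes I t 0 0 c V W := by
  intro mem n hm
  obtain ⟨code, hlen, n', hn'⟩ := h.exists_code hm
  refine ⟨code.map .op, ⟨n', ?_⟩, ?_, ?_, ?_⟩
  · simpa only [List.foldl_map, CallInstr.exec] using hn'
  · intro u
    simp [List.countP_map, Function.comp_def, CallInstr.callsNFCT]
  · intro u
    simp [List.countP_map, Function.comp_def, CallInstr.callsAdj]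
  · simp [Function.comp_def, CallInstr.cost, hlen]

/-- The results of a call are written to fresh work registers. -/
theorem Holds.exists_extend {K : Type} [Fintype K] {mem : A → I ⊕ ℕ → ℝ} {n : ℕ}
    (hm : Holds mem n V) (g : A → K → ℝ) :
    ∃ outs : K ↪ I ⊕ ℕ, ∃ n', Holds (fun a => Function.extend outs (g a) (mem a)) n'
      (V ∪ Set.range fun k a => g a k) := by
  let e := Fintype.equivFin K
  let outs : K ↪ I ⊕ ℕ := ⟨fun k => .inr (n + e k), fun k k' h => by
    simpa [Fin.val_inj] using h⟩
  refine ⟨outs, n + Fintype.card K, ?_⟩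
  rintro f (hf | ⟨k, rfl⟩)
  · obtain ⟨r, hr, hmr⟩ := hm f hf
    refine ⟨r, fun m h => (hr m h).trans_le (Nat.le_add_right _ _), fun a => ?_⟩
    refine (Function.extend_apply' _ _ _ ?_).trans (hmr a)
    rintro ⟨k, hk⟩
    have := hr (n + e k) hk.symm
    omega
  · refine ⟨outs k, fun m h => ?_, fun a => outs.injective.extend_apply _ _ _⟩
    have h' : n + (e k : ℕ) = m := Sum.inr_injective h
    have := (e k).isLt
    omega

theorem realizes_nfct (u : U) {v : termIndexSet (N u) (u : Finset (Fin d)) → A → ℝ}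
    (hv : ∀ k, v k ∈ V) :
    Realizes I t (Pi.single u 1) 0 (t.nfct u).size V
      (V ∪ Set.range fun j a => (t.nfct u).eval (fun k => v k a) j) := by
  intro mem n hm
  choose args _ hargs using fun k => hm (v k) (hv k)
  obtain ⟨outs, n', hn'⟩ := hm.exists_extend fun a => (t.nfct u).eval fun k => v k a
  refine ⟨[.nfct u args outs], ⟨n', ?_⟩, ?_, ?_, ?_⟩
  · simpa only [List.foldl, CallInstr.exec, hargs] using hn'
  · intro u'
    by_cases h : u = u'
    · subst h; simp [CallInstr.callsNFCT]
    · simp [CallInstr.callsNFCT, h, Ne.symm h]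
  · simp [CallInstr.callsAdj]
  · simp [CallInstr.cost]

theorem realizes_adj (u : U) {v : Fin M → A → ℝ} (hv : ∀ j, v j ∈ V) :
    Realizes I t 0 (Pi.single u 1) (t.adj u).size V
      (V ∪ Set.range fun k a => (t.adj u).eval (fun j => v j a) k) := by
  intro mem n hm
  choose args _ hargs using fun j => hm (v j) (hv j)
  obtain ⟨outs, n', hn'⟩ := hm.exists_extend fun a => (t.adj u).eval fun j => v j a
  refine ⟨[.adj u args outs], ⟨n', ?_⟩, ?_, ?_, ?_⟩
  · simpa only [List.foldl, CallInstr.exec, hargs] using hn'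
  · simp [CallInstr.callsNFCT]
  · intro u'
    by_cases h : u = u'
    · subst h; simp [CallInstr.callsAdj]
    · simp [CallInstr.callsAdj, h, Ne.symm h]
  · simp [CallInstr.cost]

/-- Code for the single terms is put together to code that treats every term once. -/
theorem realizes_biUnion (s : Finset U) {p q : U → U → ℕ} {c : U → ℕ} {W : U → Set (A → ℝ)}
    (h : ∀ u ∈ s, ∀ V', V ⊆ V' → Realizes I t (p u) (q u) (c u) V' (V' ∪ W u)) :
    Realizes I t (∑ u ∈ s, p u) (∑ u ∈ s, q u) (∑ u ∈ s, c u) V (V ∪ ⋃ u ∈ s, W u) := by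
  classical
  induction s using Finset.induction_on with
  | empty => simpa using Realizes.refl
  | insert u s hu ih =>
    rw [Finset.sum_insert hu, Finset.sum_insert hu, Finset.sum_insert hu, add_comm (p u),
      add_comm (q u), add_comm (c u), Finset.set_biUnion_insert]
    refine ((ih fun u' hu' => h u' (Finset.mem_insert_of_mem hu')).trans
      (h u (Finset.mem_insert_self u s) _ Set.subset_union_left)).mono ?_
    rw [Set.union_assoc, Set.union_comm (W u)]

end Calls

/-! ### One iteration of LSQR -/

section LSQR

variable {A : Type} {V : Set (A → ℝ)}

theorem Derives.inv {f : A → ℝ} (hf : f ∈ V) : Derives 2 V {f⁻¹} := by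
  refine .step (.const 1) (.step (.div (Set.mem_insert _ _) (Set.mem_insert_of_mem _ hf))
    (.done ?_))
  rintro _ rfl
  refine Or.inl ?_
  ext a
  simp

theorem norm2_eq_sqrt {K : Type} [Fintype K] (y : K → ℝ) :
    norm2 y = Real.sqrt (∑ k, y k * y k) := by
  simp [norm2, EuclideanSpace.norm_eq, sq]

theorem Derives.normalize {K : Type} [Fintype K] {f : K → A → ℝ} (hf : ∀ k, f k ∈ V) :
    Derives (3 * Fintype.card K + 4) V
      (insert (fun a => norm2 fun k => f k a)
        (Set.range fun k => (fun a => norm2 fun k => f k a)⁻¹ * f k)) := by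
  have h1 : Derives (2 * Fintype.card K + 2) V {fun a => norm2 fun k => f k a} := by
    refine ((Derives.sum Finset.univ fun k _ => Op.derives (.mul (hf k) (hf k))).trans
      ((Op.derives (.sqrt (Or.inr rfl))).mono_right ?_)).mono_cost (le_of_eq ?_)
    · rintro _ rfl
      ext a
      simp [norm2_eq_sqrt]
    · rw [Finset.card_univ]
      ring
  refine ((h1.trans (Derives.inv (Or.inr rfl)).keep).trans
    ((Derives.range fun k =>
      Op.derives (.mul (f := (fun a => norm2 fun k => f k a)⁻¹) (g := f k) ?_ ?_)).keep.mono_right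
        ?_)).mono_cost
      (le_of_eq (?_ : _ + 2 + Fintype.card K * 1 = _))
  · simp
  · simp [hf k]
  · exact Set.insert_subset (by simp) Set.subset_union_right
  · ring

/-- The half of an iteration between the calls of the transforms and those of the adjoint
transforms; `r` are the results of the transforms of the terms. -/
theorem derives_forward {m ι : Type} [Fintype m] [Fintype ι] (w : m → ℝ) {r : ι → m → A → ℝ}
    {u : m → A → ℝ} {α : A → ℝ} (hr : ∀ i j, r i j ∈ V) (hu : ∀ j, u j ∈ V) (hα : α ∈ V)
    {q : m → A → ℝ} (hq : ∀ j, q j = w j • ∑ i, r i j - α * u j) {β : A → ℝ}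
    (hβ : β = fun a => norm2 fun j => q j a) :
    Derives (Fintype.card m * (Fintype.card ι + 10) + 4) V
      (insert β (Set.range (fun j => β⁻¹ * q j)) ∪ Set.range fun j => w j • (β⁻¹ * q j)) := by
  have h1 : Derives (Fintype.card m * (Fintype.card ι + 5)) V (Set.range q) := by
    refine Derives.range fun j => ?_
    have hs := (Derives.sum (V := V) (n := 0) Finset.univ (f := fun i => r i j) fun i _ =>
      .done (by simpa using hr i j)).trans (Derives.smul (w j) (Or.inr rfl))
    refine ((hs.union (Op.derives (.mul hα (hu j)))).trans
      ((Op.derives (.sub (Or.inr (Or.inl rfl)) (Or.inr (Or.inr rfl)))).mono_right ?_)).mono_cost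
        (le_of_eq ?_)
    · rw [hq]
    · rw [Finset.card_univ]
      ring
  refine ((h1.trans (Derives.normalize fun j => Or.inr ⟨j, rfl⟩)).trans
    ((Derives.range fun j => Derives.smul (w j) (f := β⁻¹ * q j) ?_).keep.mono_right ?_)).mono_cost
      (le_of_eq ?_)
  · exact Or.inr (Or.inr ⟨j, by rw [hβ]⟩)
  · rw [← hβ]
    exact Set.union_subset_union_left _ Set.subset_union_right
  · ring

/-- The half of an iteration after the calls of the adjoint transforms; `s` are the results of
the adjoint transforms. -/
theorem derives_backward {n : Type} [Fintype n] {s v w x : n → A → ℝ} {β ρbar φbar : A → ℝ}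
    (hs : ∀ k, s k ∈ V) (hv : ∀ k, v k ∈ V) (hw : ∀ k, w k ∈ V) (hx : ∀ k, x k ∈ V)
    (hβ : β ∈ V) (hρ : ρbar ∈ V) (hφ : φbar ∈ V) {α ρ : A → ℝ}
    (hα : α = fun a => norm2 fun k => s k a - β a * v k a)
    (hρ' : ρ = fun a => Real.sqrt (ρbar a ^ 2 + β a ^ 2)) :
    Derives (Fintype.card n * 9 + 18) V
      (Set.range (fun k => α⁻¹ * (s k - β * v k)) ∪
        Set.range (fun k => α⁻¹ * (s k - β * v k) - (β / ρ * α) / ρ * w k) ∪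
        Set.range (fun k => x k + (ρbar / ρ * φbar) / ρ * w k) ∪
        {α, -(ρbar / ρ) * α, β / ρ * φbar}) := by
  replace hρ' : ρ = fun a => Real.sqrt ((ρbar * ρbar + β * β) a) := by
    rw [hρ']
    ext a
    simp only [sq, Pi.add_apply, Pi.mul_apply]
  have hneg : -(ρbar / ρ) * α = (fun _ => -1) * (ρbar / ρ) * α := by
    ext a
    simp
  rw [hneg]
  have h1 : Derives (Fintype.card n * 2) V (Set.range fun k => s k - β * v k) :=
    Derives.range fun k => .step (.mul hβ (hv k))
      (.step (.sub (Or.inr (hs k)) (Or.inl rfl)) (.done (by simp)))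
  have h2 := (h1.trans (Derives.normalize fun k => Or.inr ⟨k, rfl⟩)).keep
  have hα' : (fun a => norm2 fun k => (s k - β * v k) a) = α := hα.symm
  rw [hα'] at h2
  set v' : n → A → ℝ := fun k => α⁻¹ * (s k - β * v k)
  have h3 : Derives 14 (V ∪ insert α (Set.range v'))
      {(β / ρ * α) / ρ, (ρbar / ρ * φbar) / ρ, (fun _ => -1) * (ρbar / ρ) * α,
        β / ρ * φbar} := by
    refine .step (.mul (f := ρbar) (g := ρbar) ?_ ?_) (.step (.mul (f := β) (g := β) ?_ ?_)
      (.step (.add (f := ρbar * ρbar) (g := β * β) ?_ ?_)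
      (.step (f := ρ) (hρ' ▸ .sqrt ?_) (.step (.div (f := ρbar) (g := ρ) ?_ ?_)
      (.step (.div (f := β) (g := ρ) ?_ ?_) (.step (.mul (f := β / ρ) (g := α) ?_ ?_)
      (.step (.mul (f := ρbar / ρ) (g := φbar) ?_ ?_)
      (.step (.div (f := β / ρ * α) (g := ρ) ?_ ?_)
      (.step (.div (f := ρbar / ρ * φbar) (g := ρ) ?_ ?_) (.step (.const (-1))
      (.step (.mul (f := fun _ => -1) (g := ρbar / ρ) ?_ ?_)
      (.step (.mul (f := (fun _ => -1) * (ρbar / ρ)) (g := α) ?_ ?_)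
      (.step (.mul (f := β / ρ) (g := φbar) ?_ ?_) (.done ?_))))))))))))))
    all_goals
      simp only [Set.mem_insert_iff, Set.mem_union, Set.insert_subset_iff,
        Set.singleton_subset_iff, hβ, hρ, hφ, true_or, or_true, true_and]
  have h4 : Derives (Fintype.card n * 2 + Fintype.card n * 2)
      (V ∪ insert α (Set.range v') ∪ {(β / ρ * α) / ρ, (ρbar / ρ * φbar) / ρ,
        (fun _ => -1) * (ρbar / ρ) * α, β / ρ * φbar})
      (Set.range (fun k => v' k - (β / ρ * α) / ρ * w k) ∪
        Set.range fun k => x k + (ρbar / ρ * φbar) / ρ * w k) := by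
    refine .union (.range fun k => ?_) (.range fun k => ?_)
    · exact (Op.derives (.mul (f := (β / ρ * α) / ρ) (g := w k) (by simp) (by simp [hw k]))).trans
        (Op.derives (.sub (f := v' k) (by simp) (Or.inr rfl)))
    · exact (Op.derives (.mul (f := (ρbar / ρ * φbar) / ρ) (g := w k) (by simp)
        (by simp [hw k]))).trans (Op.derives (.add (f := x k) (by simp [hx k]) (Or.inr rfl)))
  refine ((h2.comp (h3.keep.comp h4.keep)).mono_right ?_).mono_cost (le_of_eq ?_)
  · rintro f (((⟨k, rfl⟩ | ⟨k, rfl⟩) | ⟨k, rfl⟩) | (rfl | rfl | rfl))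
    · exact Or.inl (Or.inl (Or.inr (Or.inr ⟨k, rfl⟩)))
    · exact Or.inr (Or.inl ⟨k, rfl⟩)
    · exact Or.inr (Or.inr ⟨k, rfl⟩)
    · exact Or.inl (Or.inl (Or.inr (Or.inl rfl)))
    · exact Or.inl (Or.inr (Or.inr (Or.inr (Or.inl rfl))))
    · exact Or.inl (Or.inr (Or.inr (Or.inr (Or.inr rfl))))
  · ring

end LSQR

section Grouped

variable {d M : ℕ} {U : Finset (Finset (Fin d))} {N : Finset (Fin d) → ℕ}

/-- The index set `I(U)` is the disjoint union of the sets `I_u`, `u ∈ U`, since `u` is the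
support of each `k ∈ I_u`. -/
theorem bijective_incl : Function.Bijective
    fun q : Σ u : U, termIndexSet (N u) (u : Finset (Fin d)) => incl q.1 q.2 := by
  constructor
  · rintro ⟨u, k⟩ ⟨u', k'⟩ h
    have hk : (k : Fin d → ℕ) = k' := congrArg Subtype.val h
    have hu : u = u' := by
      ext s
      rw [← (mem_termIndexSet.1 k.2).1, ← (mem_termIndexSet.1 k'.2).1, hk]
    subst hu
    rw [Subtype.ext hk]
  · rintro ⟨k, hk⟩
    obtain ⟨u, hu, hk⟩ := Finset.mem_biUnion.1 hk
    exact ⟨⟨⟨u, hu⟩, ⟨k, hk⟩⟩, rfl⟩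

theorem sum_indexSet (g : indexSet U N → ℝ) :
    ∑ k, g k = ∑ u : U, ∑ k : termIndexSet (N u) (u : Finset (Fin d)), g (incl u k) := by
  exact (Function.Bijective.sum_comp bijective_incl g).symm.trans (Fintype.sum_sigma _)

theorem mulVec_eq_sum_nfct {t : Transforms M U N} {G : Matrix (Fin M) (indexSet U N) ℝ}
    (hG : ∀ (u : U) (h : termIndexSet (N u) (u : Finset (Fin d)) → ℝ),
      (t.nfct u).eval h = (G.submatrix id (incl u)).mulVec h)
    (w : Fin M → ℝ) (v : indexSet U N → ℝ) (j : Fin M) :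
    (Matrix.diagonal w * G).mulVec v j =
      w j * ∑ u, (t.nfct u).eval (fun k => v (incl u k)) j := by
  rw [← Matrix.mulVec_mulVec, Matrix.mulVec_diagonal]
  congr 1
  simp only [hG]
  exact sum_indexSet fun k => G j k * v k

theorem transpose_mulVec_eq_adj {t : Transforms M U N} {G : Matrix (Fin M) (indexSet U N) ℝ}
    (hG : ∀ (u : U) (f : Fin M → ℝ),
      (t.adj u).eval f = (G.submatrix id (incl u)).transpose.mulVec f)
    (w : Fin M → ℝ) (y : Fin M → ℝ) (u : U) (k : termIndexSet (N u) (u : Finset (Fin d))) :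
    (Matrix.diagonal w * G).transpose.mulVec y (incl u k) =
      (t.adj u).eval (fun j => w j * y j) k := by
  rw [Matrix.transpose_mul, Matrix.diagonal_transpose, ← Matrix.mulVec_mulVec, hG]
  simp only [Matrix.mulVec, dotProduct, Matrix.transpose_apply, Matrix.submatrix_apply, id,
    Matrix.diagonal_apply, ite_mul, zero_mul, Finset.sum_ite_eq, Finset.mem_univ, if_true]

/-- The state with given values. -/
def LSQRState.ofVals {m n : Type} (a : LSQRVar m n → ℝ) : LSQRState m n where
  u j := a (.u j)
  v k := a (.v k)
  w k := a (.w k)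
  x k := a (.x k)
  α := a .α
  ρbar := a .ρbar
  φbar := a .φbar

/-- Code for one iteration: calls of the transforms, the vector operations up to the next `u`,
calls of the adjoint transforms, and the remaining vector and scalar operations. It is correct
for every state, not only for those that occur as iterates. -/
theorem realizes_lsqrStep {t : Transforms M U N} {G : Matrix (Fin M) (indexSet U N) ℝ}
    (hn : ∀ (u : U) (h : termIndexSet (N u) (u : Finset (Fin d)) → ℝ),
      (t.nfct u).eval h = (G.submatrix id (incl u)).mulVec h)
    (ha : ∀ (u : U) (f : Fin M → ℝ),
      (t.adj u).eval f = (G.submatrix id (incl u)).transpose.mulVec f)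
    (w : Fin M → ℝ) :
    Realizes (LSQRVar (Fin M) (indexSet U N)) t (fun _ => 1) (fun _ => 1)
      (∑ u, (t.nfct u).size + (M * (U.card + 10) + 4) + ∑ u, (t.adj u).size +
        ((indexSet U N).card * 9 + 18))
      (Set.range fun (i : LSQRVar (Fin M) (indexSet U N)) a => a i)
      (Set.range fun i a =>
        (lsqrStep (Matrix.diagonal w * G) (LSQRState.ofVals a)).vals i) := by
  set X : LSQRVar (Fin M) (indexSet U N) → (LSQRVar (Fin M) (indexSet U N) → ℝ) → ℝ :=
    fun i a => a i with hX
  set V : Set ((LSQRVar (Fin M) (indexSet U N) → ℝ) → ℝ) := Set.range X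
  -- the results of the transforms, and the quantities computed from them
  set r : U → Fin M → (LSQRVar (Fin M) (indexSet U N) → ℝ) → ℝ :=
    fun u j a => (t.nfct u).eval (fun k => a (.v (incl u k))) j with hr
  set q : Fin M → (LSQRVar (Fin M) (indexSet U N) → ℝ) → ℝ := fun j =>
    w j • ∑ u, r u j - X .α * X (.u j) with hq
  set β : (LSQRVar (Fin M) (indexSet U N) → ℝ) → ℝ := fun a => norm2 fun j => q j a with hβ
  set W := insert β (Set.range (fun j => β⁻¹ * q j)) ∪ Set.range fun j => w j • (β⁻¹ * q j)
  -- the results of the adjoint transforms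
  set s : (u : U) → termIndexSet (N u) (u : Finset (Fin d)) →
      (LSQRVar (Fin M) (indexSet U N) → ℝ) → ℝ :=
    fun u k a => (t.adj u).eval (fun j => (w j • (β⁻¹ * q j)) a) k
  have h1 := realizes_biUnion (I := LSQRVar (Fin M) (indexSet U N)) (t := t) (V := V)
    Finset.univ (W := fun u => Set.range (r u)) fun u _ V' hV' =>
      realizes_nfct (I := LSQRVar (Fin M) (indexSet U N)) u
        (v := fun k => X (.v (incl u k))) fun k => hV' ⟨_, rfl⟩
  have h2 := (derives_forward (V := V ∪ ⋃ u ∈ Finset.univ, Set.range (r u)) w (r := r)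
    (fun u j => Or.inr (Set.mem_biUnion (Finset.mem_univ u) ⟨j, rfl⟩))
    (fun j => Or.inl ⟨.u j, rfl⟩) (Or.inl ⟨.α, rfl⟩) (q := q) (fun j => rfl) hβ).keep.realizes
      (I := LSQRVar (Fin M) (indexSet U N)) (t := t)
  have h3 := realizes_biUnion (I := LSQRVar (Fin M) (indexSet U N)) (t := t)
    (V := V ∪ (⋃ u ∈ Finset.univ, Set.range (r u)) ∪ W)
    Finset.univ (W := fun u => Set.range (s u)) fun u _ V' hV' =>
      realizes_adj (I := LSQRVar (Fin M) (indexSet U N)) u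
        (v := fun j => w j • (β⁻¹ * q j)) fun j => hV' (Or.inr (Or.inr ⟨j, rfl⟩))
  -- the adjoint transforms give the product with the transpose of the system matrix
  set b : indexSet U N → (LSQRVar (Fin M) (indexSet U N) → ℝ) → ℝ := fun k a =>
    (Matrix.diagonal w * G).transpose.mulVec (fun j => (β⁻¹ * q j) a) k
  have hbs : ∀ u k, b (incl u k) = s u k := fun u k => funext fun a =>
    transpose_mulVec_eq_adj ha w _ u k
  have hin : ∀ i, X i ∈
      V ∪ (⋃ u ∈ Finset.univ, Set.range (r u)) ∪ W ∪ ⋃ u ∈ Finset.univ, Set.range (s u) :=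
    fun i => Or.inl (Or.inl (Or.inl ⟨i, rfl⟩))
  set α : (LSQRVar (Fin M) (indexSet U N) → ℝ) → ℝ := fun a =>
    norm2 fun k => b k a - β a * a (.v k) with hα
  set ρ : (LSQRVar (Fin M) (indexSet U N) → ℝ) → ℝ := fun a =>
    Real.sqrt (a .ρbar ^ 2 + β a ^ 2) with hρ
  have h4 := (derives_backward (s := b) (v := fun k => X (.v k)) (w := fun k => X (.w k))
    (x := fun k => X (.x k)) (ρbar := X .ρbar) (φbar := X .φbar)
    (fun k => by
      obtain ⟨⟨u, k⟩, rfl⟩ := bijective_incl.surjective k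
      rw [hbs]
      exact Or.inr (Set.mem_biUnion (Finset.mem_univ u) ⟨k, rfl⟩))
    (fun k => hin _) (fun k => hin _) (fun k => hin _) (Or.inl (Or.inr (Or.inl (Or.inl rfl))))
    (hin _) (hin _) hα hρ).keep.realizes (I := LSQRVar (Fin M) (indexSet U N)) (t := t)
  have hstep : ∀ a, lsqrStep (Matrix.diagonal w * G) (LSQRState.ofVals a) =
      { u := fun j => (β⁻¹ * q j) a
        v := fun k => (α⁻¹ * (b k - β * X (.v k))) a
        w := fun k => (α⁻¹ * (b k - β * X (.v k)) -
          (β / ρ * α) / ρ * X (.w k)) a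
        x := fun k => (X (.x k) +
          ((X .ρbar / ρ) * X .φbar) / ρ * X (.w k)) a
        α := α a
        ρbar := (-(X .ρbar / ρ) * α) a
        φbar := (β / ρ * X .φbar) a } := by
    intro a
    have hqa : (Matrix.diagonal w * G).mulVec (LSQRState.ofVals a).v -
        (LSQRState.ofVals a).α • (LSQRState.ofVals a).u = fun j => q j a := by
      ext j
      rw [Pi.sub_apply, mulVec_eq_sum_nfct hn]
      simp [hq, hr, hX, LSQRState.ofVals]
    unfold lsqrStep
    rw [hqa]
    rfl
  have h5 := (((h1.trans h2).trans h3).trans h4).mono (X := Set.range fun i a =>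
      (lsqrStep (Matrix.diagonal w * G) (LSQRState.ofVals a)).vals i) (by
    simp only [hstep]
    rintro _ ⟨i, rfl⟩
    cases i with
    | u j => exact Or.inl (Or.inl (Or.inr (Or.inl (Or.inr ⟨j, rfl⟩))))
    | v k => exact Or.inr <| Or.inl (Or.inl (Or.inl ⟨k, rfl⟩))
    | w k => exact Or.inr <| Or.inl (Or.inl (Or.inr ⟨k, rfl⟩))
    | x k => exact Or.inr <| Or.inl (Or.inr ⟨k, rfl⟩)
    | α => exact Or.inr <| Or.inr (Or.inl rfl)
    | ρbar => exact Or.inr <| Or.inr (Or.inr (Or.inl rfl))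
    | φbar => exact Or.inr <| Or.inr (Or.inr (Or.inr rfl)))
  have hsum : ∑ u : U, Pi.single u 1 = fun _ : U => 1 := Finset.univ_sum_single fun _ => 1
  simpa only [hsum, Finset.sum_const_zero, add_zero, zero_add, Fintype.card_fin,
    Fintype.card_coe] using h5

end Grouped

/-! ### Rounding of the nodes -/

theorem abs_prod_sub_prod_le {ι : Type*} (u : Finset ι) {a b : ι → ℝ} {δ : ℝ}
    (ha : ∀ s ∈ u, |a s| ≤ 1) (hb : ∀ s ∈ u, |b s| ≤ 1) (hab : ∀ s ∈ u, |a s - b s| ≤ δ) :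
    |∏ s ∈ u, a s - ∏ s ∈ u, b s| ≤ u.card * δ := by
  classical
  induction u using Finset.induction_on with
  | empty => simp
  | insert s u hs ih =>
    have ih' := ih (fun r hr => ha r (Finset.mem_insert_of_mem hr))
      (fun r hr => hb r (Finset.mem_insert_of_mem hr))
      (fun r hr => hab r (Finset.mem_insert_of_mem hr))
    have h1 : |∏ r ∈ u, a r| ≤ 1 := by
      rw [Finset.abs_prod]
      exact Finset.prod_le_one (fun r _ => abs_nonneg _)
        fun r hr => ha r (Finset.mem_insert_of_mem hr)
    have h2 := hb s (Finset.mem_insert_self s u)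
    have h3 := hab s (Finset.mem_insert_self s u)
    rw [Finset.prod_insert hs, Finset.prod_insert hs, Finset.card_insert_of_notMem hs]
    have h4 : a s * ∏ r ∈ u, a r - b s * ∏ r ∈ u, b r =
        (a s - b s) * ∏ r ∈ u, a r + b s * (∏ r ∈ u, a r - ∏ r ∈ u, b r) := by ring
    rw [h4]
    calc _ ≤ |(a s - b s) * ∏ r ∈ u, a r| + |b s * (∏ r ∈ u, a r - ∏ r ∈ u, b r)| :=
          abs_add_le _ _
      _ ≤ δ * 1 + 1 * (u.card * δ) := by
          rw [abs_mul, abs_mul]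
          have := (abs_nonneg _).trans h3
          gcongr
      _ = _ := by push_cast; ring

/-- The number of the last point of the grid `2 π l / 2 ^ p` that is at most `t`. -/
noncomputable def gridIndex (p : ℕ) (t : ℝ) : ℕ := ⌊t * 2 ^ p / (2 * Real.pi)⌋₊

theorem gridIndex_lt (p : ℕ) {t : ℝ} (ht : t ≤ Real.pi) : gridIndex p t < 2 ^ p := by
  have hpi := Real.pi_pos
  refine (Nat.floor_lt' (by positivity)).2 ?_
  rw [div_lt_iff₀ (by positivity)]
  push_cast
  have h2 : (0 : ℝ) < 2 ^ p := by positivity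
  nlinarith

theorem abs_mul_sub_gridAngle_le (p k : ℕ) {t : ℝ} (ht : 0 ≤ t) :
    |k * t - gridAngle p k (gridIndex p t)| ≤ k * (2 * Real.pi / 2 ^ p) := by
  have hpi := Real.pi_pos
  have h0 : 0 ≤ t * 2 ^ p / (2 * Real.pi) := by positivity
  have h1 := Nat.floor_le h0
  have h2 := Nat.lt_floor_add_one (t * 2 ^ p / (2 * Real.pi))
  have h3 : k * t - gridAngle p k (gridIndex p t) = k * (2 * Real.pi / 2 ^ p) *
      (t * 2 ^ p / (2 * Real.pi) - ⌊t * 2 ^ p / (2 * Real.pi)⌋₊) := by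
    unfold gridAngle gridIndex
    field_simp
  rw [h3, abs_mul, abs_of_nonneg (by positivity), abs_of_nonneg (by linarith)]
  exact mul_le_of_le_one_right (by positivity) (by linarith)

/-- The point of the grid to which the node `x` is rounded, in the directions `u`. -/
noncomputable def nodeIndex {d : ℕ} (p : ℕ) (u : Finset (Fin d)) (x : Fin d → ℝ) : Fin d → ℕ :=
  fun s => if s ∈ u then gridIndex p (Real.arccos (x s)) else 0

theorem nodeIndex_mem_grid {d : ℕ} (p : ℕ) (u : Finset (Fin d)) (x : Fin d → ℝ) :
    nodeIndex p u x ∈ grid (2 ^ p) u := by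
  refine mem_grid.2 ⟨fun s hs => ?_, fun s hs => ?_⟩
  · simpa [nodeIndex, hs] using gridIndex_lt p (Real.arccos_le_pi (x s))
  · simp [nodeIndex, hs]

theorem abs_cosKernel_nodeIndex_sub_le {d : ℕ} (p : ℕ) (u : Finset (Fin d)) (x : Fin d → ℝ)
    {k : Fin d → ℕ} {n : ℕ} (hk : ∀ s ∈ u, k s ≤ n) :
    |cosKernel p u k (nodeIndex p u x) - ∏ s ∈ u, Real.cos (k s * Real.arccos (x s))| ≤
      u.card * (n * (2 * Real.pi / 2 ^ p)) := by
  refine abs_prod_sub_prod_le u (fun s _ => Real.abs_cos_le_one _)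
    (fun s _ => Real.abs_cos_le_one _) fun s hs => ?_
  refine (Real.abs_cos_sub_cos_le _ _).trans ?_
  rw [abs_sub_comm, nodeIndex, if_pos hs]
  refine (abs_mul_sub_gridAngle_le p (k s) (Real.arccos_nonneg _)).trans ?_
  have hpi := Real.pi_pos
  have := hk s hs
  gcongr

/-! ### The transforms -/

/-- The exponent of the number of grid points in each direction for the term `u` with
parameter `n`: the smallest power of two that is at least `n`, oversampled by `2 ^ κ`. -/
def gridExponent (κ n : ℕ) : ℕ := Nat.clog 2 n + κ

theorem le_two_pow_gridExponent (κ n : ℕ) : n * 2 ^ κ ≤ 2 ^ gridExponent κ n := by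
  rw [gridExponent, pow_add]
  exact Nat.mul_le_mul_right _ (Nat.le_pow_clog one_lt_two n)

theorem two_pow_gridExponent_le (κ : ℕ) {n : ℕ} (hn : 1 ≤ n) :
    2 ^ gridExponent κ n ≤ 2 ^ (κ + 1) * n := by
  have h : 2 ^ Nat.clog 2 n ≤ 2 * n := by
    rcases hn.eq_or_lt with rfl | hn
    · simp
    · have h1 := Nat.pow_pred_clog_lt_self one_lt_two hn
      have h2 : 2 ^ Nat.clog 2 n = 2 ^ (Nat.clog 2 n).pred * 2 :=
        (congrArg (2 ^ ·) (Nat.succ_pred (Nat.clog_pos one_lt_two hn).ne').symm).trans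
          (pow_succ _ _)
      omega
  calc 2 ^ gridExponent κ n = 2 ^ κ * 2 ^ Nat.clog 2 n := by rw [gridExponent, pow_add, mul_comm]
    _ ≤ 2 ^ κ * (2 * n) := Nat.mul_le_mul_left _ h
    _ = _ := by ring

/-- The parameter `n = 1`, for which `log n = 0`, is the reason for the term `m`. -/
theorem pow_mul_gridExponent_le (κ r : ℕ) {n : ℕ} {m : ℝ} (hn : 1 ≤ n) (hm : 1 ≤ m) :
    (n : ℝ) ^ r * (gridExponent κ n + 1) ≤ (2 * κ + 6) * ((n : ℝ) ^ r * Real.log n + m) := by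
  rcases hn.eq_or_lt with rfl | hn
  · simp only [gridExponent, Nat.clog_one_right]
    push_cast
    rw [one_pow, Real.log_one]
    nlinarith [(Nat.cast_nonneg κ : (0 : ℝ) ≤ κ)]
  · have hn' : (2 : ℝ) ≤ n := by exact_mod_cast hn
    have hlog2 := Real.log_two_gt_d9
    have hlog : Real.log 2 ≤ Real.log n := Real.log_le_log two_pos hn'
    have hclog : (Nat.clog 2 n : ℝ) ≤ 4 * Real.log n := by
      have h1 : ((2 : ℝ) ^ (Nat.clog 2 n).pred) ≤ n := by
        exact_mod_cast (Nat.pow_pred_clog_lt_self one_lt_two hn).le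
      have h2 := Real.log_le_log (by positivity) h1
      rw [Real.log_pow] at h2
      have h3 : (Nat.clog 2 n : ℝ) = (Nat.clog 2 n).pred + 1 := by
        exact_mod_cast (Nat.succ_pred (Nat.clog_pos one_lt_two hn).ne').symm
      have h4 : (0 : ℝ) ≤ (Nat.clog 2 n).pred := Nat.cast_nonneg _
      nlinarith
    have h5 : (gridExponent κ n : ℝ) + 1 ≤ (2 * κ + 6) * Real.log n := by
      unfold gridExponent
      push_cast
      nlinarith [(Nat.cast_nonneg κ : (0 : ℝ) ≤ κ)]
    calc (n : ℝ) ^ r * (gridExponent κ n + 1)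
        ≤ (n : ℝ) ^ r * ((2 * κ + 6) * Real.log n) := by gcongr
      _ = (2 * κ + 6) * ((n : ℝ) ^ r * Real.log n) := by ring
      _ ≤ _ := by gcongr; linarith

theorem grid_pow_mul_le (κ : ℕ) {ds r n : ℕ} (hr : r ≤ ds) {m : ℝ} (hn : 1 ≤ n) (hm : 1 ≤ m) :
    ((2 ^ gridExponent κ n : ℕ) : ℝ) ^ r * (gridExponent κ n + 1) ≤
      (2 ^ (κ + 1)) ^ ds * (2 * κ + 6) * ((n : ℝ) ^ r * Real.log n + m) := by
  have h1 : ((2 ^ gridExponent κ n : ℕ) : ℝ) ≤ 2 ^ (κ + 1) * n := by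
    exact_mod_cast two_pow_gridExponent_le κ hn
  calc ((2 ^ gridExponent κ n : ℕ) : ℝ) ^ r * (gridExponent κ n + 1)
      ≤ (2 ^ (κ + 1) * n) ^ r * (gridExponent κ n + 1) := by gcongr
    _ = (2 ^ (κ + 1)) ^ r * ((n : ℝ) ^ r * (gridExponent κ n + 1)) := by ring
    _ ≤ (2 ^ (κ + 1)) ^ ds * ((2 * κ + 6) * ((n : ℝ) ^ r * Real.log n + m)) :=
        mul_le_mul (pow_le_pow_right₀ (one_le_pow₀ one_le_two) hr)
          (pow_mul_gridExponent_le κ r hn hm) (by positivity) (by positivity)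
    _ = _ := by ring

section Transforms

variable {d M : ℕ} {U : Finset (Finset (Fin d))} {N : Finset (Fin d) → ℕ}

/-- The support of a multi-index. -/
def support (k : Fin d → ℕ) : Finset (Fin d) := Finset.univ.filter fun s => k s ≠ 0

theorem support_of_mem_termIndexSet {n : ℕ} {u : Finset (Fin d)} {k : Fin d → ℕ}
    (hk : k ∈ termIndexSet n u) : support k = u := by
  ext s
  simp only [support, Finset.mem_filter, Finset.mem_univ, true_and, (mem_termIndexSet.1 hk).1]

theorem mem_grid_of_mem_termIndexSet (κ : ℕ) {n : ℕ} (hn : 1 ≤ n) {u : Finset (Fin d)}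
    {k : Fin d → ℕ} (hk : k ∈ termIndexSet n u) : k ∈ grid (2 ^ gridExponent κ n) u := by
  obtain ⟨h1, h2⟩ := mem_termIndexSet.1 hk
  refine mem_grid.2 ⟨fun s hs => ?_, fun s hs => not_not.1 (mt (h1 s).1 hs)⟩
  have h3 := h2 s hs
  have h4 : n * 1 ≤ n * 2 ^ κ := Nat.mul_le_mul_left _ Nat.one_le_two_pow
  have h5 := le_two_pow_gridExponent κ n
  omega

/-- The matrix `(T_k(x_j))` with the nodes rounded, for the column `k`, to the grid that
belongs to the term `supp k`. -/
noncomputable def roundedMatrix (κ : ℕ) (x : Fin M → Fin d → ℝ)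
    (U : Finset (Finset (Fin d))) (N : Finset (Fin d) → ℕ) :
    Matrix (Fin M) (indexSet U N) ℝ :=
  Matrix.of fun j k => Real.sqrt 2 ^ (support (k : Fin d → ℕ)).card *
    cosKernel (gridExponent κ (N (support (k : Fin d → ℕ)))) (support (k : Fin d → ℕ)) k
      (nodeIndex (gridExponent κ (N (support (k : Fin d → ℕ)))) (support (k : Fin d → ℕ)) (x j))

theorem roundedMatrix_incl (κ : ℕ) (x : Fin M → Fin d → ℝ) (u : U)
    (k : termIndexSet (N u) (u : Finset (Fin d))) (j : Fin M) :
    roundedMatrix κ x U N j (incl u k) = Real.sqrt 2 ^ (u : Finset (Fin d)).card *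
      cosKernel (gridExponent κ (N u)) u k (nodeIndex (gridExponent κ (N u)) u (x j)) := by
  have h : support ((incl u k : indexSet U N) : Fin d → ℕ) = u :=
    support_of_mem_termIndexSet k.2
  simp only [roundedMatrix, Matrix.of_apply, h]
  rfl

theorem abs_roundedMatrix_sub_le {ds κ : ℕ} {ε : ℝ}
    (hκ : Real.sqrt 2 ^ ds * (ds * (2 * Real.pi)) ≤ ε * 2 ^ κ) (x : Fin M → Fin d → ℝ)
    (hU : ∀ u ∈ U, u.card ≤ ds) (hN : ∀ u ∈ U, 1 ≤ N u) (j : Fin M) (k : indexSet U N) :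
    |roundedMatrix κ x U N j k - systemMatrix x U N j k| ≤ ε := by
  obtain ⟨⟨u, k⟩, rfl⟩ := bijective_incl.surjective k
  have hs : support (k : Fin d → ℕ) = u := support_of_mem_termIndexSet k.2
  have hT : systemMatrix x U N j (incl u k) = Real.sqrt 2 ^ (u : Finset (Fin d)).card *
      ∏ s ∈ (u : Finset (Fin d)), Real.cos ((k : Fin d → ℕ) s * Real.arccos (x j s)) := by
    change Real.sqrt 2 ^ (support (k : Fin d → ℕ)).card * ∏ s ∈ support (k : Fin d → ℕ), _ = _
    rw [hs]
    rfl
  have hk : ∀ s ∈ (u : Finset (Fin d)), (k : Fin d → ℕ) s ≤ N u := fun s h =>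
    ((mem_termIndexSet.1 k.2).2 s h).trans (Nat.sub_le _ _)
  have hpi := Real.pi_pos
  have h2 : (1 : ℝ) ≤ Real.sqrt 2 := Real.one_le_sqrt.2 one_le_two
  have hL : (N u : ℝ) * 2 ^ κ ≤ 2 ^ gridExponent κ (N u) := by
    exact_mod_cast le_two_pow_gridExponent κ (N u)
  have hN' : (1 : ℝ) ≤ N u := by exact_mod_cast hN u u.2
  have hc : ((u : Finset (Fin d)).card : ℝ) ≤ ds := by exact_mod_cast hU u u.2
  rw [roundedMatrix_incl, hT, ← mul_sub, abs_mul, abs_of_nonneg (by positivity)]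
  calc _ ≤ Real.sqrt 2 ^ ds * (ds * (N u * (2 * Real.pi / (N u * 2 ^ κ)))) := by
        refine mul_le_mul (pow_le_pow_right₀ h2 (hU u u.2))
          ((abs_cosKernel_nodeIndex_sub_le _ _ _ hk).trans ?_) (abs_nonneg _) (by positivity)
        gcongr
    _ = Real.sqrt 2 ^ ds * (ds * (2 * Real.pi)) / 2 ^ κ := by
        field_simp
    _ ≤ ε := by
        rw [div_le_iff₀ (by positivity)]
        exact hκ

/-- The factor by which the number `L ^ |u| (log₂ L + 1)`, `L` the number of grid points in each
direction, may exceed `n ^ |u| log n + m`, `m ≥ 1`. -/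
noncomputable def costUnit (ds κ : ℕ) : ℝ := (2 ^ (κ + 1)) ^ ds * (2 * κ + 6)

theorem card_termIndexSet_le (κ : ℕ) {ds n : ℕ} {u : Finset (Fin d)} (hu : u.card ≤ ds)
    (hn : 1 ≤ n) {m : ℝ} (hm : 1 ≤ m) : ((termIndexSet n u).card : ℝ) ≤
      costUnit ds κ * ((n : ℝ) ^ u.card * Real.log n + m) := by
  refine le_trans ?_ (grid_pow_mul_le κ hu hn hm)
  have h : (termIndexSet n u).card ≤ (2 ^ gridExponent κ n) ^ u.card :=
    card_grid (2 ^ gridExponent κ n) u ▸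
      Finset.card_le_card fun _ => mem_grid_of_mem_termIndexSet κ hn
  have h' : ((termIndexSet n u).card : ℝ) ≤ ((2 ^ gridExponent κ n : ℕ) : ℝ) ^ u.card := by
    exact_mod_cast h
  refine h'.trans (le_mul_of_one_le_right (by positivity) ?_)
  have : (0 : ℝ) ≤ gridExponent κ n := Nat.cast_nonneg _
  linarith

theorem one_le_costUnit (ds κ : ℕ) : 1 ≤ costUnit ds κ := by
  have h1 : (1 : ℝ) ≤ (2 ^ (κ + 1)) ^ ds := one_le_pow₀ (one_le_pow₀ one_le_two)
  have h2 : (1 : ℝ) ≤ 2 * κ + 6 := by linarith [(Nat.cast_nonneg κ : (0 : ℝ) ≤ κ)]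
  exact one_le_mul_of_one_le_of_one_le h1 h2

theorem transform_size_le (κ : ℕ) {ds n s c : ℕ} {u : Finset (Fin d)} (hu : u.card ≤ ds)
    (hn : 1 ≤ n) {m : ℝ} (hm : 1 ≤ m)
    (hs : s = 3 * c + (2 ^ gridExponent κ n) ^ u.card +
        u.card * (2 ^ gridExponent κ n) ^ u.card * (12 * (gridExponent κ n + 1)))
    (hc : (c : ℝ) ≤ costUnit ds κ * ((n : ℝ) ^ u.card * Real.log n + m)) :
    (s : ℝ) ≤ (4 + 12 * ds) * costUnit ds κ * ((n : ℝ) ^ u.card * Real.log n + m) := by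
  have h1 := grid_pow_mul_le κ hu hn hm
  rw [← costUnit] at h1
  have h0 : (0 : ℝ) ≤ gridExponent κ n := Nat.cast_nonneg _
  have hp : (0 : ℝ) ≤ ((2 ^ gridExponent κ n : ℕ) : ℝ) ^ u.card := by positivity
  have hu' : (u.card : ℝ) ≤ ds := by exact_mod_cast hu
  rw [hs]
  set B := costUnit ds κ * ((n : ℝ) ^ u.card * Real.log n + m)
  set L := ((2 ^ gridExponent κ n : ℕ) : ℝ) ^ u.card with hL
  calc _ = 3 * (c : ℝ) + L + 12 * (u.card * (L * (gridExponent κ n + 1))) := by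
        rw [hL]; push_cast; ring
    _ ≤ 3 * B + B + 12 * (ds * B) := by
        gcongr
        nlinarith
    _ = _ := by ring

theorem exists_nfct {ds : ℕ} (κ : ℕ) (x : Fin M → Fin d → ℝ) (hM : 0 < M)
    (hU : ∀ u ∈ U, u.card ≤ ds) (hN : ∀ u ∈ U, 1 ≤ N u) (u : U) :
    ∃ P : Program (termIndexSet (N u) (u : Finset (Fin d))) (Fin M),
      (∀ h, P.eval h = ((roundedMatrix κ x U N).submatrix id (incl u)).mulVec h) ∧
      (P.size : ℝ) ≤ (4 + 12 * ds) * costUnit ds κ *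
        ((N u : ℝ) ^ (u : Finset (Fin d)).card * Real.log (N u) + M) := by
  have hM' : (1 : ℝ) ≤ M := by exact_mod_cast hM
  obtain ⟨P, hP, he⟩ := exists_program_cosKernel (gridExponent κ (N u))
    (u : Finset (Fin d)) (Real.sqrt 2 ^ (u : Finset (Fin d)).card)
    (fun k : termIndexSet (N u) (u : Finset (Fin d)) => (k : Fin d → ℕ))
    (fun j : Fin M => nodeIndex (gridExponent κ (N u)) u (x j))
    (fun k => mem_grid_of_mem_termIndexSet κ (hN u u.2) k.2) (fun j => nodeIndex_mem_grid _ _ _)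
  refine ⟨P, fun h => ?_, transform_size_le κ (hU u u.2) (hN u u.2) hM' hP ?_⟩
  · ext j
    simp only [he, Matrix.mulVec, dotProduct, Matrix.submatrix_apply, id, roundedMatrix_incl]
  · rw [Fintype.card_coe]
    exact card_termIndexSet_le κ (hU u u.2) (hN u u.2) hM'

/-- The kernel of the grid transform is symmetric, so that exchanging the positions of inputs
and outputs gives the adjoint. -/
theorem exists_adj {ds : ℕ} (κ : ℕ) (x : Fin M → Fin d → ℝ) (hM : 0 < M)
    (hU : ∀ u ∈ U, u.card ≤ ds) (hN : ∀ u ∈ U, 1 ≤ N u) (u : U) :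
    ∃ P : Program (Fin M) (termIndexSet (N u) (u : Finset (Fin d))),
      (∀ f, P.eval f = ((roundedMatrix κ x U N).submatrix id (incl u)).transpose.mulVec f) ∧
      (P.size : ℝ) ≤ (4 + 12 * ds) * costUnit ds κ *
        ((N u : ℝ) ^ (u : Finset (Fin d)).card * Real.log (N u) + M) := by
  have hM' : (1 : ℝ) ≤ M := by exact_mod_cast hM
  obtain ⟨P, hP, he⟩ := exists_program_cosKernel (gridExponent κ (N u))
    (u : Finset (Fin d)) (Real.sqrt 2 ^ (u : Finset (Fin d)).card)
    (fun j : Fin M => nodeIndex (gridExponent κ (N u)) u (x j))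
    (fun k : termIndexSet (N u) (u : Finset (Fin d)) => (k : Fin d → ℕ))
    (fun j => nodeIndex_mem_grid _ _ _) (fun k => mem_grid_of_mem_termIndexSet κ (hN u u.2) k.2)
  refine ⟨P, fun f => ?_, transform_size_le κ (hU u u.2) (hN u u.2) hM' hP ?_⟩
  · ext k
    rw [he]
    refine Finset.sum_congr rfl fun j _ => ?_
    change _ = roundedMatrix κ x U N j (incl u k) * f j
    rw [roundedMatrix_incl, cosKernel_comm]
  · rw [Fintype.card_fin]
    have hB : (0 : ℝ) ≤ (N u : ℝ) ^ (u : Finset (Fin d)).card * Real.log (N u) := by positivity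
    exact (le_add_of_nonneg_left hB).trans
      (le_mul_of_one_le_left (by positivity) (one_le_costUnit ds κ))

theorem exists_transforms {ds κ : ℕ} {ε : ℝ}
    (hκ : Real.sqrt 2 ^ ds * (ds * (2 * Real.pi)) ≤ ε * 2 ^ κ) (x : Fin M → Fin d → ℝ)
    (hM : 0 < M) (hU : ∀ u ∈ U, u.card ≤ ds) (hN : ∀ u ∈ U, 1 ≤ N u) :
    ∃ t : Transforms M U N, t.IsNFCT x ε (roundedMatrix κ x U N) ∧ ∀ u : U,
      ((t.nfct u).size : ℝ) ≤ (4 + 12 * ds) * costUnit ds κ *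
        ((N u : ℝ) ^ (u : Finset (Fin d)).card * Real.log (N u) + M) ∧
      ((t.adj u).size : ℝ) ≤ (4 + 12 * ds) * costUnit ds κ *
        ((N u : ℝ) ^ (u : Finset (Fin d)).card * Real.log (N u) + M) := by
  choose nfct hn hn' using exists_nfct κ x hM hU hN
  choose adj ha ha' using exists_adj κ x hM hU hN
  exact ⟨⟨nfct, adj⟩, ⟨abs_roundedMatrix_sub_le hκ x hU hN, hn, ha⟩, fun u => ⟨hn' u, ha' u⟩⟩

/-- If `2 ^ κ` is large enough for the accuracy `ε`, the bounds hold with a constant that depends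
on `ds` and `κ` only. -/
theorem fastLSQR_of_oversampling {ds κ : ℕ} {ε : ℝ}
    (hκ : Real.sqrt 2 ^ ds * (ds * (2 * Real.pi)) ≤ ε * 2 ^ κ) (x : Fin M → Fin d → ℝ)
    (w : Fin M → ℝ) (hM : 0 < M) (hU0 : U.Nonempty) (hU : ∀ u ∈ U, u.card ≤ ds)
    (hN : ∀ u ∈ U, 1 ≤ N u) :
    FastLSQR ((2 * (4 + 12 * ds) + 9) * costUnit ds κ + 33) ε x w U N := by
  obtain ⟨t, ht, hsize⟩ := exists_transforms hκ x hM hU hN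
  obtain ⟨code, ⟨n, hn⟩, hp, hq, hcost⟩ :=
    realizes_lsqrStep ht.nfct_eval ht.adj_eval w _ 0 (holds_inputs 0)
  choose out _ hout using fun i => hn _ ⟨i, rfl⟩
  have hM' : (1 : ℝ) ≤ M := by exact_mod_cast hM
  have hE := one_le_costUnit ds κ
  have hB : ∀ u : U, (0 : ℝ) ≤
      (N u : ℝ) ^ (u : Finset (Fin d)).card * Real.log (N u) + M := fun u => by positivity
  set E := costUnit ds κ
  have hC : (4 + 12 * ds) * E ≤ (2 * (4 + 12 * ds) + 9) * E + 33 := by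
    nlinarith [(Nat.cast_nonneg ds : (0 : ℝ) ≤ ds)]
  refine ⟨t, roundedMatrix κ x U N, ⟨code, out⟩, ht, ⟨fun y i => ?_, hp, hq⟩, fun u => ?_, ?_⟩
  · ext v
    exact hout v _
  · exact ⟨(hsize u).1.trans (mul_le_mul_of_nonneg_right hC (hB u)),
      (hsize u).2.trans (mul_le_mul_of_nonneg_right hC (hB u))⟩
  · set T := ∑ u ∈ U, (N u : ℝ) ^ u.card * Real.log (N u) + (M : ℝ) * U.card with hT
    have hsum : ∑ u : U, ((N u : ℝ) ^ (u : Finset (Fin d)).card * Real.log (N u) + M) = T := by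
      rw [Finset.univ_eq_attach,
        Finset.sum_attach U fun u => (N u : ℝ) ^ u.card * Real.log (N u) + M,
        Finset.sum_add_distrib, Finset.sum_const, nsmul_eq_mul, mul_comm (U.card : ℝ)]
    have hMU : (M : ℝ) * U.card ≤ T := by
      rw [hT]
      have : (0 : ℝ) ≤ ∑ u ∈ U, (N u : ℝ) ^ u.card * Real.log (N u) :=
        Finset.sum_nonneg fun u _ => by positivity
      linarith
    have hU1 : (1 : ℝ) ≤ U.card := by exact_mod_cast hU0.card_pos
    have hMT : (M : ℝ) ≤ T := by nlinarith
    have h1 : ∑ u : U, ((t.nfct u).size : ℝ) ≤ (4 + 12 * ds) * E * T := by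
      rw [← hsum, Finset.mul_sum]
      exact Finset.sum_le_sum fun u _ => (hsize u).1
    have h2 : ∑ u : U, ((t.adj u).size : ℝ) ≤ (4 + 12 * ds) * E * T := by
      rw [← hsum, Finset.mul_sum]
      exact Finset.sum_le_sum fun u _ => (hsize u).2
    have h3 : ((indexSet U N).card : ℝ) ≤ E * T := by
      have h : ((indexSet U N).card : ℝ) ≤ ∑ u ∈ U, ((termIndexSet (N u) u).card : ℝ) := by
        exact_mod_cast Finset.card_biUnion_le
      refine h.trans ?_
      rw [← hsum, Finset.mul_sum, Finset.univ_eq_attach, ← Finset.sum_attach]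
      exact Finset.sum_le_sum fun u _ => card_termIndexSet_le κ (hU u u.2) (hN u u.2) hM'
    have h4 : ((CallProgram.cost ⟨code, out⟩ t : ℕ) : ℝ) = ∑ u : U, ((t.nfct u).size : ℝ) +
        (M * (U.card + 10) + 4) + ∑ u : U, ((t.adj u).size : ℝ) +
          ((indexSet U N).card * 9 + 18) := by
      rw [CallProgram.cost, hcost]
      push_cast
      ring
    rw [h4]
    nlinarith

end Transforms

end GroupedLSQR

theorem mainTheorem6 (ds : ℕ) (ε : ℝ) (hε : 0 < ε) :
    ∃ C : ℝ, ∀ (d M : ℕ) (x : Fin M → Fin d → ℝ) (U : Finset (Finset (Fin d)))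
      (N : Finset (Fin d) → ℕ),
      0 < M → (∀ j s, x j s ∈ Set.Icc (-1 : ℝ) 1) →
      U.Nonempty → (∀ u ∈ U, u.card ≤ ds) → (∀ u ∈ U, 1 ≤ N u) →
      -- the least-squares problem for the nodes `x`, without weights
      GroupedLSQR.FastLSQR C ε x (fun _ => 1) U N ∧
      -- the weighted least-squares problem for the nodes scaled by `1 - θ`
      ∀ θ ∈ Set.Ioo (0 : ℝ) 1,
        GroupedLSQR.FastLSQR C ε (fun j => (1 - θ) • x j)
          (fun j => Real.sqrt (GroupedLSQR.chebyshevDensity ((1 - θ) • x j))) U N := by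
  -- the oversampling factor `2 ^ κ` makes the rounding error at most `ε`
  obtain ⟨κ, hκ⟩ := pow_unbounded_of_one_lt
    (Real.sqrt 2 ^ ds * (ds * (2 * Real.pi)) / ε) one_lt_two
  rw [div_lt_iff₀ hε, mul_comm _ ε] at hκ
  exact ⟨_, fun d M x U N hM _ hU0 hU hN =>
    ⟨GroupedLSQR.fastLSQR_of_oversampling hκ.le x _ hM hU0 hU hN, fun θ _ =>
      GroupedLSQR.fastLSQR_of_oversampling hκ.le _ _ hM hU0 hU hN⟩⟩
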